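/- Let $d\ge 1$ and $s\ge 0$ be integers. For $\pi\in S_k$ let $W_\pi$ be the operator on $(\mathbb C^d)^{\otimes k}$ with $W_\pi|x_1\rangle\cdots|x_k\rangle=|x_{\pi^{-1}(1)}\rangle\cdots|x_{\pi^{-1}(k)}\rangle$, let the symmetric subspace be the space of vectors fixed by all $W_\pi$, $\pi\in S_k$, let $\kappa_k$ be its dimension, and let $\Pi^{(k)}_{\mathrm{sym}}$ be the orthogonal projector onto it. Let $\mathrm d\psi$ be the distribution of a Haar random pure state, i.e. the law of $U|0\rangle$ for $U$ distributed according to the normalized Haar measure on the unitary group $\mathrm U(d)$. The standard symmetric joint measurement $\mathcal M_s$ on $(\mathbb C^d)^{\otimes s}$ has as outcomes the pure states $\psi$ and one extra outcome "fail", with elements $$A_\psi=\kappa_s\,|\psi\rangle\langle\psi|^{\otimes s}\,\mathrm d\psi ,\qquad A_{\mathrm{fail}}=I-\Pi^{(s)}_{\mathrm{sym}}.$$ Let $\rho=|\varphi\rangle\langle\varphi|$ be a pure state on $\mathbb C^d$. Then $\mathcal M_s$ is a POVM, and measuring $\rho^{\otimes s}$ with $\mathcal M_s$ defines, by the Born rule,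 a probability law on the outcomes. If a random outcome has this law, it is almost surely not "fail", and the random density matrix $\Psi=|\psi\rangle\langle\psi|$, where $\psi$ is the outcome, satisfies $$\mathbb E[\Psi]=\frac{I+s\rho}{d+s}$$ and $$\mathbb E[\Psi\otimes\Psi]=\frac{2}{(d+s)(d+s+1)}\left((I+s\rho)^{\otimes 2}-\frac{s(s+1)}{2}\,\rho^{\otimes 2}\right)\Pi^{(2)}_{\mathrm{sym}} ,$$ both expectations being of integrable (entrywise) matrix-valued random variables. -/

import Mathlib

open MeasureTheory
open scoped Matrix

noncomputable section

namespace QuditShadow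

/-! ### Pure states of a qudit -/

/-- Unit vectors of `ℂ^d`. -/
abbrev Ket (d : ℕ) : Type := Metric.sphere (0 : EuclideanSpace ℂ (Fin d)) 1

/-- The rank-one projector `|ψ⟩⟨ψ|`. -/
def ketbra {d : ℕ} (ψ : Ket d) : Matrix (Fin d) (Fin d) ℂ :=
  Matrix.of fun i j => ψ.1 i * star (ψ.1 j)

/-- A density matrix is pure if it is `|φ⟩⟨φ|` for a unit vector `φ`. -/
def IsPureState {d : ℕ} (ρ : Matrix (Fin d) (Fin d) ℂ) : Prop :=
  ∃ φ : Ket d, ρ = ketbra φ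

/-! ### The Haar measure on pure states -/

instance unitaryMeasurableSpace (d : ℕ) : MeasurableSpace (Matrix.unitaryGroup (Fin d) ℂ) :=
  borel _

instance unitaryBorelSpace (d : ℕ) : BorelSpace (Matrix.unitaryGroup (Fin d) ℂ) := ⟨rfl⟩

instance unitaryTopologicalGroup (d : ℕ) : IsTopologicalGroup (Matrix.unitaryGroup (Fin d) ℂ) :=
  inferInstanceAs (IsTopologicalGroup (unitary (Matrix (Fin d) (Fin d) ℂ)))

instance unitaryCompactSpace (d : ℕ) : CompactSpace (Matrix.unitaryGroup (Fin d) ℂ) := by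
  have hK : IsCompact (Set.univ.pi fun _ : Fin d => Set.univ.pi fun _ : Fin d =>
      Metric.closedBall (0 : ℂ) 1) :=
    isCompact_univ_pi fun _ => isCompact_univ_pi fun _ => isCompact_closedBall _ _
  have hc : IsClosed (Matrix.unitaryGroup (Fin d) ℂ : Set (Matrix (Fin d) (Fin d) ℂ)) := by
    have : (Matrix.unitaryGroup (Fin d) ℂ : Set (Matrix (Fin d) (Fin d) ℂ))
        = {A | A * star A = 1} := by
      ext A
      exact Matrix.mem_unitaryGroup_iff
    rw [this]
    exact isClosed_eq (continuous_id.mul continuous_star) continuous_const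
  refine isCompact_iff_compactSpace.mp (hK.of_isClosed_subset hc ?_)
  intro A hA i _ j _
  simpa using entry_norm_bound_of_unitary hA i j

/-- The Haar measure on the unitary group `U(d)`, of total mass one. -/
def haarUnitary (d : ℕ) : Measure (Matrix.unitaryGroup (Fin d) ℂ) :=
  Measure.haarMeasure ⊤

/-- The action of a unitary matrix on a unit vector. -/
def unitaryKet {d : ℕ} (U : Matrix.unitaryGroup (Fin d) ℂ) (ψ : Ket d) : Ket d :=
  ⟨Matrix.toEuclideanCLM (n := Fin d) (𝕜 := ℂ) U.1 ψ.1, by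
    have hU : Matrix.toEuclideanCLM (n := Fin d) (𝕜 := ℂ) U.1 ∈
        unitary (EuclideanSpace ℂ (Fin d) →L[ℂ] EuclideanSpace ℂ (Fin d)) :=
      Unitary.map_mem _ U.2
    have h := ContinuousLinearMap.norm_map_of_mem_unitary hU ψ.1
    have hψ : ‖ψ.1‖ = 1 := by simp
    rw [mem_sphere_zero_iff_norm, h, hψ]⟩

/-- The first vector of the computational basis. -/
def ketZero (d : ℕ) [NeZero d] : Ket d :=
  ⟨EuclideanSpace.single 0 1, by simp⟩

/-- The distribution of a Haar random state: the law of `U|0⟩` for Haar random `U`. -/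
def haarState (d : ℕ) [NeZero d] : Measure (Ket d) :=
  (haarUnitary d).map fun U => unitaryKet U (ketZero d)

/-! ### Several qudits and the symmetric subspace -/

/-- Operators on `(ℂ^d)^{⊗s}`, in the computational basis `|x₁⟩⋯|x_s⟩`. -/
abbrev Op (d s : ℕ) : Type := Matrix (Fin s → Fin d) (Fin s → Fin d) ℂ

/-- The tensor power `A^{⊗s}`. -/
def tensorPow {d : ℕ} (A : Matrix (Fin d) (Fin d) ℂ) (s : ℕ) : Op d s :=
  Matrix.of fun x y => ∏ i, A (x i) (y i)

/-- The permutation operator `W_π|x₁⟩⋯|x_s⟩ = |x_{π⁻¹(1)}⟩⋯|x_{π⁻¹(s)}⟩`. -/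
def permOp (d : ℕ) {s : ℕ} (π : Equiv.Perm (Fin s)) : Op d s :=
  Matrix.of fun x y => if x = (fun i => y (π⁻¹ i)) then 1 else 0

/-- The symmetric subspace: the vectors fixed by every `W_π`. -/
def symSubspace (d s : ℕ) : Submodule ℂ (EuclideanSpace ℂ (Fin s → Fin d)) :=
  ⨅ π : Equiv.Perm (Fin s),
    LinearMap.eqLocus (Matrix.toEuclideanCLM (𝕜 := ℂ) (permOp d π)).toLinearMap LinearMap.id

/-- The dimension `κ_s` of the symmetric subspace. -/
def symDim (d s : ℕ) : ℕ := Module.finrank ℂ (symSubspace d s)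

/-- The orthogonal projector onto the symmetric subspace. -/
def symProj (d s : ℕ) : Op d s :=
  (Matrix.toEuclideanCLM (n := Fin s → Fin d) (𝕜 := ℂ)).symm (symSubspace d s).starProjection

/-! ### Measurements -/

/-- The entrywise integral of a matrix-valued function. -/
def matIntegral {Ω n : Type*} [MeasurableSpace Ω] (μ : Measure Ω) (F : Ω → Matrix n n ℂ) :
    Matrix n n ℂ :=
  Matrix.of fun i j => ∫ ω, F ω i j ∂μ

open scoped ComplexOrder in
/-- Positive operator-valued measures with outcomes in a measurable space. -/
structure IsPOVM {Y n : Type*} [MeasurableSpace Y] [Fintype n] [DecidableEq n]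
    (M : Set Y → Matrix n n ℂ) : Prop where
  posSemidef : ∀ E, MeasurableSet E → (M E).PosSemidef
  iUnion : ∀ E : ℕ → Set Y, (∀ k, MeasurableSet (E k)) → Pairwise (Function.onFun Disjoint E) →
    HasSum (fun k => M (E k)) (M (⋃ k, E k))
  univ : M Set.univ = 1

/-- The Born rule: `P` is the law of the outcome of measuring the state `σ` with `M`. -/
def IsOutcomeLaw {Y n : Type*} [MeasurableSpace Y] [Fintype n]
    (M : Set Y → Matrix n n ℂ) (σ : Matrix n n ℂ) (P : Measure Y) : Prop :=
  IsProbabilityMeasure P ∧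
    ∀ E, MeasurableSet E → ((P.real E : ℝ) : ℂ) = (M E * σ).trace

/-- Outcomes of the standard symmetric joint measurement: a pure state (given by a unit vector)
or the "fail" outcome `Sum.inr ()`. -/
abbrev Outcome (d : ℕ) : Type := Ket d ⊕ Unit

open Classical in
/-- The standard symmetric joint measurement on `s` qudits: the elements
`A_ψ = κ_s |ψ⟩⟨ψ|^{⊗s} dψ`, with `dψ` the Haar measure on pure states, and the element
`I - Π_sym` for the outcome "fail". -/
def symMeasurement (d s : ℕ) [NeZero d] (E : Set (Outcome d)) : Op d s :=
  matIntegral ((haarState d).restrict (Sum.inl ⁻¹' E))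
      (fun ψ => (symDim d s : ℂ) • tensorPow (ketbra ψ) s)
    + if Sum.inr () ∈ E then 1 - symProj d s else 0

/-- The density matrix `Ψ = |ψ⟩⟨ψ|` of an outcome `ψ`, with the value zero on "fail". -/
def outcomeState {d : ℕ} : Outcome d → Matrix (Fin d) (Fin d) ℂ :=
  Sum.elim ketbra fun _ => 0

end QuditShadow

end

noncomputable section

namespace QuditShadow

/-! ### Invariance of the Haar distribution of pure states -/

section Invariance

variable {d : ℕ}

/-! Since `ρ^{⊗s}` is fixed by the symmetric projector, "fail" has probability zero. On the pure
states the outcome has density `κ_s |⟨φ|ψ⟩|^{2s}` with respect to Haar measure, so everything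
reduces to Haar integrals of polynomials in `ψ` times conjugates of polynomials in `ψ`.

These integrals come from one integration-by-parts rule, `integral_inner_mul`. If `g` and `h` are
holomorphic and `g` is homogeneous of degree `k`, then `(d + k) ∫ ⟨b,ψ⟩ g conj h = ∫ g conj (∂_b
h)`: up to a constant, multiplication by a linear form is adjoint to differentiation. The rule
follows from unitary invariance of the Haar state: differentiate along the one-parameter groups that
rotate the phase of a single vector, polarize, and sum over a basis with Euler's identity and `‖ψ‖ =
1`.

The rule is used twice. Applied inductively to symmetric tensors, it shows that the moment operator
is a scalar multiple of the symmetric projector; its trace is one, so `κ_s` times it is the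
projector (`symDim_smul_haarMoment`). This normalizes the POVM. Applied to one or two linear forms
times `⟨φ,·⟩^s`, it expresses the weighted moments as explicit multiples of `overlapMoment φ s`
(`haarPairing_one_one`, `haarPairing_two_two`). The total mass of the Born law says that this number
is `1/κ_s`, which removes the last unknown. -/

@[simp]
theorem coe_unitaryKet (U : Matrix.unitaryGroup (Fin d) ℂ) (ψ : Ket d) :
    (unitaryKet U ψ).1 = Matrix.toEuclideanCLM (n := Fin d) (𝕜 := ℂ) U.1 ψ.1 := rfl

theorem unitaryKet_mul (U V : Matrix.unitaryGroup (Fin d) ℂ) (ψ : Ket d) :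
    unitaryKet (U * V) ψ = unitaryKet U (unitaryKet V ψ) := by
  apply Subtype.ext
  simp [map_mul]

theorem continuous_unitaryKet_left (ψ : Ket d) :
    Continuous fun U : Matrix.unitaryGroup (Fin d) ℂ => unitaryKet U ψ := by
  refine Continuous.subtype_mk ?_ _
  refine (PiLp.continuous_toLp 2 _).comp (f := fun U : Matrix.unitaryGroup (Fin d) ℂ =>
    U.1 *ᵥ ψ.1.ofLp) ?_
  exact Continuous.matrix_mulVec continuous_subtype_val continuous_const

theorem continuous_unitaryKet_right (U : Matrix.unitaryGroup (Fin d) ℂ) :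
    Continuous (unitaryKet U : Ket d → Ket d) :=
  Continuous.subtype_mk ((ContinuousLinearMap.continuous _).comp continuous_subtype_val) _

instance isProbabilityMeasure_haarUnitary : IsProbabilityMeasure (haarUnitary d) :=
  ⟨by simpa [haarUnitary] using Measure.haarMeasure_self (G := Matrix.unitaryGroup (Fin d) ℂ) (K₀ := ⊤)⟩

instance isMulLeftInvariant_haarUnitary : (haarUnitary d).IsMulLeftInvariant :=
  inferInstanceAs (Measure.haarMeasure _).IsMulLeftInvariant

variable [NeZero d]

instance isProbabilityMeasure_haarState : IsProbabilityMeasure (haarState d) :=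
  Measure.isProbabilityMeasure_map (continuous_unitaryKet_left _).measurable.aemeasurable

/-- The distribution of a Haar random state is invariant under unitary matrices. -/
theorem map_unitaryKet_haarState (U : Matrix.unitaryGroup (Fin d) ℂ) :
    (haarState d).map (unitaryKet U) = haarState d := by
  have h : Measurable fun V : Matrix.unitaryGroup (Fin d) ℂ => unitaryKet V (ketZero d) :=
    (continuous_unitaryKet_left _).measurable
  unfold haarState
  rw [Measure.map_map (continuous_unitaryKet_right U).measurable h]
  conv_rhs => rw [← map_mul_left_eq_self (haarUnitary d) U]
  rw [Measure.map_map h (continuous_const_mul U).measurable]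
  congr 1
  funext V
  exact (unitaryKet_mul U V _).symm

theorem integral_unitaryKet (U : Matrix.unitaryGroup (Fin d) ℂ) {f : Ket d → ℂ}
    (hf : Continuous f) :
    ∫ ψ, f (unitaryKet U ψ) ∂haarState d = ∫ ψ, f ψ ∂haarState d := by
  conv_rhs => rw [← map_unitaryKet_haarState U]
  rw [integral_map (continuous_unitaryKet_right U).measurable.aemeasurable
    hf.aestronglyMeasurable]

theorem integrable_haarState {f : Ket d → ℂ} (hf : Continuous f) :
    Integrable f (haarState d) :=
  hf.integrable_of_hasCompactSupport (HasCompactSupport.of_compactSpace f)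

end Invariance

/-! ### Rank-one projectors and phase rotations -/

section Rotation

variable {d : ℕ}

theorem ketbra_apply (ψ : Ket d) (i j : Fin d) : ketbra ψ i j = ψ.1 i * star (ψ.1 j) := rfl

theorem sum_star_mul_self (ψ : Ket d) : ∑ i, star (ψ.1 i) * ψ.1 i = 1 := by
  have h : inner ℂ ψ.1 ψ.1 = (1 : ℂ) := by
    rw [inner_self_eq_norm_sq_to_K, norm_eq_of_mem_sphere]; simp
  rw [← h, PiLp.inner_apply]
  exact Finset.sum_congr rfl fun i _ => mul_comm _ _

theorem ketbra_mul_self (ψ : Ket d) : ketbra ψ * ketbra ψ = ketbra ψ := by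
  ext i j
  simp only [Matrix.mul_apply, ketbra_apply]
  calc ∑ k, ψ.1 i * star (ψ.1 k) * (ψ.1 k * star (ψ.1 j))
      = ψ.1 i * star (ψ.1 j) * ∑ k, star (ψ.1 k) * ψ.1 k := by
        rw [Finset.mul_sum]; exact Finset.sum_congr rfl fun k _ => by ring
    _ = _ := by rw [sum_star_mul_self, mul_one]

theorem star_ketbra (ψ : Ket d) : star (ketbra ψ) = ketbra ψ := by
  ext i j
  simp [Matrix.star_apply, ketbra_apply, mul_comm]

/-- The unitary matrix that multiplies `w` by `e^{it}` and fixes its orthogonal complement. -/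
def phaseRotation (w : Ket d) (t : ℝ) : Matrix.unitaryGroup (Fin d) ℂ :=
  ⟨1 + (Complex.exp (t * Complex.I) - 1) • ketbra w, by
    rw [Matrix.mem_unitaryGroup_iff]
    have hz : Complex.exp (t * Complex.I) * star (Complex.exp (t * Complex.I)) = 1 := by
      rw [Complex.star_def, ← Complex.exp_conj, ← Complex.exp_add]
      simp
    generalize Complex.exp (t * Complex.I) = z at hz
    -- For a projector `P`, the product `(1 + (z-1)P)(1 + (z̄-1)P)` is `1 + cP`, where `c` is this
    -- sum and equals `|z|² - 1`.
    have hc : (z - 1) + ((star z - 1) + (z - 1) * (star z - 1)) = 0 := by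
      linear_combination hz
    rw [star_add, star_one, star_smul, star_ketbra, star_sub, star_one, add_mul, mul_add, mul_add,
      one_mul, one_mul, mul_one, smul_mul_smul_comm, ketbra_mul_self, add_assoc, ← add_smul,
      ← add_smul, add_comm (star z - 1), add_assoc, add_comm _ (star z - 1), hc, zero_smul,
      add_zero]⟩

theorem coe_unitaryKet_phaseRotation (w ψ : Ket d) (t : ℝ) :
    (unitaryKet (phaseRotation w t) ψ).1 =
      ψ.1 + (Complex.exp (t * Complex.I) - 1) • inner ℂ w.1 ψ.1 • w.1 := by
  ext i
  have h : (ketbra w *ᵥ ψ.1.ofLp) i = inner ℂ w.1 ψ.1 * w.1 i := by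
    rw [PiLp.inner_apply, Finset.sum_mul]
    change ∑ k, ketbra w i k * ψ.1 k = _
    refine Finset.sum_congr rfl fun k _ => ?_
    simp only [ketbra_apply, RCLike.inner_apply, Complex.star_def]
    ring
  rw [coe_unitaryKet, Matrix.ofLp_toEuclideanCLM, phaseRotation, Matrix.add_mulVec,
    Matrix.one_mulVec, Matrix.smul_mulVec]
  simp [h]

end Rotation

/-! ### Infinitesimal invariance -/

section Infinitesimal

variable {d : ℕ} [NeZero d]

/-- The integral of `f` along the rotated state does not depend on the angle, so its derivative at
angle zero vanishes; `I • ⟨w,ψ⟩ • w` is the velocity of the rotation. Only real differentiability is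
asked of `f`, because it will be applied to `g · conj h`. -/
theorem integral_fderiv_phase_eq_zero {f : EuclideanSpace ℂ (Fin d) → ℂ} (hf : ContDiff ℝ 1 f)
    (w : Ket d) :
    ∫ ψ : Ket d, fderiv ℝ f ψ.1 (Complex.I • inner ℂ w.1 ψ.1 • w.1) ∂haarState d = 0 := by
  set γ : ℝ → Ket d → EuclideanSpace ℂ (Fin d) := fun t ψ =>
    ψ.1 + (Complex.exp (t * Complex.I) - 1) • inner ℂ w.1 ψ.1 • w.1 with hγ
  set γ' : ℝ → Ket d → EuclideanSpace ℂ (Fin d) := fun t ψ =>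
    (Complex.exp (t * Complex.I) * Complex.I) • inner ℂ w.1 ψ.1 • w.1 with hγ'
  have hγd : ∀ t ψ, HasDerivAt (fun t => γ t ψ) (γ' t ψ) t := by
    intro t ψ
    have h1 : HasDerivAt (fun t : ℝ => (t : ℂ) * Complex.I) Complex.I t := by
      simpa using (Complex.ofRealCLM.hasDerivAt (x := t)).mul_const Complex.I
    exact ((h1.cexp.sub_const 1).smul_const _).const_add _
  have hγc : Continuous fun p : ℝ × Ket d => γ p.1 p.2 := by simp only [hγ]; fun_prop
  have hγc' : Continuous fun p : ℝ × Ket d => γ' p.1 p.2 := by simp only [hγ']; fun_prop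
  have hF' : Continuous fun p : ℝ × Ket d => fderiv ℝ f (γ p.1 p.2) (γ' p.1 p.2) :=
    ((hf.continuous_fderiv (by norm_num)).comp hγc).clm_apply hγc'
  -- Compactness of `[-1,1]` times the sphere gives the constant that dominates the derivative under
  -- the integral sign.
  obtain ⟨C, hC⟩ := ((isCompact_Icc (a := (-1 : ℝ)) (b := 1)).prod
    (isCompact_univ (X := Ket d))).exists_bound_of_continuousOn hF'.continuousOn
  have hcont : ∀ t, Continuous fun ψ => f (γ t ψ) := fun t =>
    hf.continuous.comp (hγc.comp (by fun_prop : Continuous fun ψ : Ket d => (t, ψ)))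
  have key := (hasDerivAt_integral_of_dominated_loc_of_deriv_le (μ := haarState d) (𝕜 := ℝ)
    (F := fun t ψ => f (γ t ψ)) (F' := fun t ψ => fderiv ℝ f (γ t ψ) (γ' t ψ)) (x₀ := (0 : ℝ))
    (s := Set.Icc (-1) 1) (bound := fun _ => C) (Icc_mem_nhds (by norm_num) (by norm_num))
    (Filter.Eventually.of_forall fun t => (hcont t).aestronglyMeasurable)
    (integrable_haarState (hcont 0))
    (hF'.comp (by fun_prop : Continuous fun ψ : Ket d => ((0 : ℝ), ψ))).aestronglyMeasurable
    (Filter.Eventually.of_forall fun ψ t ht => hC (t, ψ) ⟨ht, trivial⟩)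
    (integrable_const C)
    (Filter.Eventually.of_forall fun ψ t _ =>
      ((hf.differentiable (by norm_num)) _).hasFDerivAt.comp_hasDerivAt t (hγd t ψ))).2
  have hconst : (fun t => ∫ ψ, f (γ t ψ) ∂haarState d) =
      fun _ => ∫ ψ : Ket d, f ψ.1 ∂haarState d := by
    funext t
    have h := integral_unitaryKet (phaseRotation w t)
      (f := fun ψ : Ket d => f ψ.1) (hf.continuous.comp continuous_subtype_val)
    simpa only [hγ, coe_unitaryKet_phaseRotation] using h
  rw [hconst] at key
  have := key.unique (hasDerivAt_const (0 : ℝ) _)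
  simpa [hγ, hγ'] using this

end Infinitesimal

/-! ### Integration by parts on pure states -/

section Parts

open scoped ComplexConjugate

variable {d : ℕ}

/-- The integrand of the infinitesimal invariance identity in the complex direction `|a⟩⟨b|`. -/
def invarianceDefect (g h : EuclideanSpace ℂ (Fin d) → ℂ) (a b : EuclideanSpace ℂ (Fin d))
    (ψ : Ket d) : ℂ :=
  inner ℂ b ψ.1 * fderiv ℂ g ψ.1 a * conj (h ψ.1) -
    inner ℂ ψ.1 a * g ψ.1 * conj (fderiv ℂ h ψ.1 b)

theorem continuous_invarianceDefect {g h : EuclideanSpace ℂ (Fin d) → ℂ} (hg : ContDiff ℂ 1 g)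
    (hh : ContDiff ℂ 1 h) (a b : EuclideanSpace ℂ (Fin d)) :
    Continuous (invarianceDefect g h a b) := by
  have h1 := hg.continuous_fderiv (by norm_num)
  have h2 := hh.continuous_fderiv (by norm_num)
  have h3 := hg.continuous
  have h4 := hh.continuous
  unfold invarianceDefect
  fun_prop

variable [NeZero d]

/-- The product rule applied to `g · conj h` along the velocity `I • ⟨w,ψ⟩ • w` gives `I` times the
defect: conjugation turns `I` into `-I` in the second term, hence the minus sign there. -/
theorem integral_invarianceDefect_unit {g h : EuclideanSpace ℂ (Fin d) → ℂ}
    (hg : ContDiff ℂ 1 g) (hh : ContDiff ℂ 1 h) (w : Ket d) :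
    ∫ ψ, invarianceDefect g h w.1 w.1 ψ ∂haarState d = 0 := by
  have hf : ContDiff ℝ 1 fun x => g x * conj (h x) :=
    (hg.restrict_scalars ℝ).mul
      ((Complex.conjCLE.toContinuousLinearMap.contDiff).comp (hh.restrict_scalars ℝ))
  have h0 := integral_fderiv_phase_eq_zero hf w
  have hpt : ∀ ψ : Ket d, fderiv ℝ (fun x => g x * conj (h x)) ψ.1
      (Complex.I • inner ℂ w.1 ψ.1 • w.1) = Complex.I * invarianceDefect g h w.1 w.1 ψ := by
    intro ψ
    have hg' := ((hg.differentiable (by norm_num)) ψ.1).hasFDerivAt.restrictScalars ℝ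
    have hh' := Complex.conjCLE.toContinuousLinearMap.hasFDerivAt.comp ψ.1
      (((hh.differentiable (by norm_num)) ψ.1).hasFDerivAt.restrictScalars ℝ)
    have := (hg'.mul hh').fderiv
    simp only [Function.comp_def] at this
    erw [this]
    simp [invarianceDefect, inner_conj_symm]
    ring
  simp only [hpt, integral_const_mul] at h0
  exact (mul_eq_zero.mp h0).resolve_left Complex.I_ne_zero

theorem integral_invarianceDefect_self {g h : EuclideanSpace ℂ (Fin d) → ℂ}
    (hg : ContDiff ℂ 1 g) (hh : ContDiff ℂ 1 h) (w : EuclideanSpace ℂ (Fin d)) :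
    ∫ ψ, invarianceDefect g h w w ψ ∂haarState d = 0 := by
  rcases eq_or_ne w 0 with rfl | hw
  · simp [invarianceDefect]
  · have hw' : ‖w‖ ≠ 0 := norm_ne_zero_iff.mpr hw
    obtain ⟨u, hu⟩ : ∃ u : Ket d, w = (‖w‖ : ℂ) • u.1 :=
      ⟨⟨(‖w‖ : ℂ)⁻¹ • w, by simp [norm_smul, hw']⟩, by
        rw [smul_smul, mul_inv_cancel₀ (by exact_mod_cast hw'), one_smul]⟩
    have hpt : ∀ ψ, invarianceDefect g h w w ψ =
        (‖w‖ : ℂ) ^ 2 * invarianceDefect g h u.1 u.1 ψ := by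
      intro ψ
      -- The norm is made opaque so that rewriting `w` does not also rewrite inside `‖w‖`.
      generalize ‖w‖ = r at hu
      rw [hu]
      simp only [invarianceDefect, inner_smul_left, inner_smul_right, map_smul, smul_eq_mul,
        map_mul, Complex.conj_ofReal]
      ring
    simp only [hpt, integral_const_mul, integral_invarianceDefect_unit hg hh, mul_zero]

/-- Infinitesimal unitary invariance of the Haar distribution, in all complex directions. -/
theorem integral_invarianceDefect {g h : EuclideanSpace ℂ (Fin d) → ℂ}
    (hg : ContDiff ℂ 1 g) (hh : ContDiff ℂ 1 h) (a b : EuclideanSpace ℂ (Fin d)) :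
    ∫ ψ, invarianceDefect g h a b ψ ∂haarState d = 0 := by
  -- The defect is linear in `a` and conjugate-linear in `b`, so polarization recovers it from its
  -- diagonal values.
  have hpol : ∀ ψ, invarianceDefect g h a b ψ =
      (1 / 4 : ℂ) * (invarianceDefect g h (a + b) (a + b) ψ
        - invarianceDefect g h (a - b) (a - b) ψ)
      + (Complex.I / 4) * (invarianceDefect g h (a + Complex.I • b) (a + Complex.I • b) ψ
        - invarianceDefect g h (a - Complex.I • b) (a - Complex.I • b) ψ) := by
    intro ψ
    simp only [invarianceDefect, inner_add_left, inner_add_right, inner_sub_left, inner_sub_right,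
      inner_smul_left, inner_smul_right, map_add, map_sub, map_smul, smul_eq_mul, map_mul,
      Complex.conj_I]
    ring_nf
    simp only [Complex.I_sq]
    ring
  have hi : ∀ w, Integrable (invarianceDefect g h w w) (haarState d) := fun w =>
    integrable_haarState (continuous_invarianceDefect hg hh w w)
  have h0 := integral_invarianceDefect_self (d := d) hg hh
  have hi' : ∀ (c : ℂ) (v w), Integrable (fun ψ => c * (invarianceDefect g h v v ψ -
      invarianceDefect g h w w ψ)) (haarState d) := fun c v w => ((hi v).sub (hi w)).const_mul c
  simp only [hpol]
  rw [integral_add (hi' _ _ _) (hi' _ _ _), integral_const_mul, integral_const_mul,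
    integral_sub (hi _) (hi _), integral_sub (hi _) (hi _)]
  simp [h0]

omit [NeZero d] in
theorem sum_smul_single (x : EuclideanSpace ℂ (Fin d)) :
    ∑ c, x c • EuclideanSpace.single c (1 : ℂ) = x := by
  ext i
  simp [Finset.sum_apply, Pi.single_apply]

/-- Integration by parts for Haar random states: `g` is homogeneous of degree `k`. -/
theorem integral_inner_mul {g h : EuclideanSpace ℂ (Fin d) → ℂ}
    (hg : ContDiff ℂ 1 g) (hh : ContDiff ℂ 1 h) {k : ℕ}
    (hk : ∀ x, fderiv ℂ g x x = k * g x) (b : EuclideanSpace ℂ (Fin d)) :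
    ((d : ℂ) + k) * ∫ ψ : Ket d, inner ℂ b ψ.1 * g ψ.1 * conj (h ψ.1) ∂haarState d =
      ∫ ψ : Ket d, g ψ.1 * conj (fderiv ℂ h ψ.1 b) ∂haarState d := by
  set e : Fin d → EuclideanSpace ℂ (Fin d) := fun c => EuclideanSpace.single c 1
  set p : Fin d → EuclideanSpace ℂ (Fin d) →L[ℂ] ℂ := fun c => EuclideanSpace.proj c
  -- Invariance is applied to `x_c g` in the direction `e_c`. Summing over `c`, the first term
  -- yields `∑ ∂_c (x_c g) = (d + k) g` by homogeneity, and the second collapses because `∑ |ψ_c|² =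
  -- 1`.
  have hgc : ∀ c, ContDiff ℂ 1 fun x => p c x * g x := fun c => (p c).contDiff.mul hg
  have hsum : ∀ ψ : Ket d, ∑ c, invarianceDefect (fun x => p c x * g x) h (e c) b ψ =
      ((d : ℂ) + k) * (inner ℂ b ψ.1 * g ψ.1 * conj (h ψ.1)) -
        g ψ.1 * conj (fderiv ℂ h ψ.1 b) := by
    intro ψ
    have h1 : ∀ c, fderiv ℂ (fun x => p c x * g x) ψ.1 (e c) =
        g ψ.1 + fderiv ℂ g ψ.1 (ψ.1 c • e c) := by
      intro c
      rw [fderiv_fun_mul (p c).differentiableAt ((hg.differentiable (by norm_num)) ψ.1),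
        ContinuousLinearMap.fderiv]
      simp [p, e]
      ring
    have h2 : ∑ c, fderiv ℂ (fun x => p c x * g x) ψ.1 (e c) = ((d : ℂ) + k) * g ψ.1 := by
      simp only [h1, Finset.sum_add_distrib, ← map_sum]
      rw [sum_smul_single, hk]
      simp
      ring
    have h3 : ∑ c, inner ℂ ψ.1 (e c) * p c ψ.1 = 1 := by
      rw [← sum_star_mul_self ψ]
      exact Finset.sum_congr rfl fun c _ => by
        simp [e, p, EuclideanSpace.inner_single_right]
    simp only [invarianceDefect, Finset.sum_sub_distrib]
    have h4 : ∑ c, inner ℂ b ψ.1 * fderiv ℂ (fun x => p c x * g x) ψ.1 (e c) * conj (h ψ.1) =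
        inner ℂ b ψ.1 * (((d : ℂ) + k) * g ψ.1) * conj (h ψ.1) := by
      rw [← h2, Finset.mul_sum, Finset.sum_mul]
    have h5 : ∑ c, inner ℂ ψ.1 (e c) * (p c ψ.1 * g ψ.1) * conj (fderiv ℂ h ψ.1 b) =
        g ψ.1 * conj (fderiv ℂ h ψ.1 b) := by
      rw [← one_mul (g ψ.1 * conj _), ← h3, Finset.sum_mul]
      exact Finset.sum_congr rfl fun c _ => by ring
    rw [h4, h5]
    ring
  have hint := integral_finsetSum (μ := haarState d) Finset.univ fun c _ =>
    integrable_haarState (continuous_invarianceDefect (hgc c) hh (e c) b)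
  have hg0 := hg.continuous
  have hh0 := hh.continuous
  have hh1 := hh.continuous_fderiv (by norm_num)
  simp only [hsum, integral_invarianceDefect (hgc _) hh, Finset.sum_const_zero] at hint
  rw [integral_sub (integrable_haarState (by fun_prop)) (integrable_haarState (by fun_prop)),
    integral_const_mul] at hint
  exact sub_eq_zero.mp hint

end Parts

/-! ### Symmetric tensors and homogeneous forms -/

section Forms

/-- A tensor on `(ℂ^d)^{⊗k}` is symmetric if its coordinates are invariant under permutations. -/
def IsSymmTensor {d k : ℕ} (v : (Fin k → Fin d) → ℂ) : Prop :=
  ∀ (π : Equiv.Perm (Fin k)) (y : Fin k → Fin d), v (y ∘ π) = v y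

theorem IsSymmTensor.cons {d k : ℕ} {v : (Fin (k + 1) → Fin d) → ℂ} (hv : IsSymmTensor v)
    (b : Fin d) : IsSymmTensor fun y => v (Fin.cons b y) := by
  intro π y
  beta_reduce
  -- This permutation fixes the index `0` and acts as `π` on the remaining ones.
  rw [← hv (Equiv.Perm.decomposeFin.symm (0, π)) (Fin.cons b y)]
  congr 1
  funext i
  refine Fin.cases ?_ (fun j => ?_) i <;> simp

theorem IsSymmTensor.cons_cons_comm {d k : ℕ} {v : (Fin (k + 2) → Fin d) → ℂ}
    (hv : IsSymmTensor v) (b c : Fin d) (y : Fin k → Fin d) :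
    v (Fin.cons b (Fin.cons c y : Fin (k + 1) → Fin d)) =
      v (Fin.cons c (Fin.cons b y : Fin (k + 1) → Fin d)) := by
  rw [← hv (Equiv.swap 0 1) (Fin.cons c (Fin.cons b y : Fin (k + 1) → Fin d))]
  congr 1
  funext i
  refine Fin.cases ?_ (fun j => Fin.cases ?_ (fun l => ?_) j) i
  · simp
  · simp
  · have h : Equiv.swap (0 : Fin (k + 2)) 1 l.succ.succ = l.succ.succ :=
      Equiv.swap_apply_of_ne_of_ne (Fin.succ_ne_zero _)
        (fun h => Fin.succ_ne_zero l (Fin.succ_injective _ h))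
    simp [h]

theorem sum_cons {d k : ℕ} (f : (Fin (k + 1) → Fin d) → ℂ) :
    ∑ y, f y = ∑ c, ∑ y : Fin k → Fin d, f (Fin.cons c y) := by
  rw [← (Fin.consEquiv fun _ => Fin d).sum_comp, Fintype.sum_prod_type]
  rfl

/-- The homogeneous form `x ↦ ⟨v̄|x^{⊗k}⟩` with coefficient tensor `v`. -/
def tensorForm {d k : ℕ} (v : (Fin k → Fin d) → ℂ) (x : EuclideanSpace ℂ (Fin d)) : ℂ :=
  ∑ y, v y * ∏ i, x (y i)

theorem tensorForm_succ {d k : ℕ} (v : (Fin (k + 1) → Fin d) → ℂ)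
    (x : EuclideanSpace ℂ (Fin d)) :
    tensorForm v x = ∑ c, x c * tensorForm (fun y => v (Fin.cons c y)) x := by
  rw [tensorForm, sum_cons]
  refine Finset.sum_congr rfl fun c _ => ?_
  rw [tensorForm, Finset.mul_sum]
  refine Finset.sum_congr rfl fun y _ => ?_
  rw [Fin.prod_univ_succ]
  simp only [Fin.cons_zero, Fin.cons_succ]
  ring

theorem contDiff_apply_euclidean {d : ℕ} (c : Fin d) :
    ContDiff ℂ 1 fun x : EuclideanSpace ℂ (Fin d) => x c :=
  (EuclideanSpace.proj (𝕜 := ℂ) c).contDiff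

theorem contDiff_tensorForm {d k : ℕ} (v : (Fin k → Fin d) → ℂ) :
    ContDiff ℂ 1 (tensorForm v) :=
  ContDiff.sum fun _ _ => contDiff_const.mul (contDiff_prod fun _ _ => contDiff_apply_euclidean _)

theorem fderiv_apply_euclidean {d : ℕ} (c : Fin d) (x b : EuclideanSpace ℂ (Fin d)) :
    fderiv ℂ (fun x : EuclideanSpace ℂ (Fin d) => x c) x b = b c := by
  have h := (EuclideanSpace.proj c : EuclideanSpace ℂ (Fin d) →L[ℂ] ℂ).fderiv (x := x)
  exact congrArg (fun L : EuclideanSpace ℂ (Fin d) →L[ℂ] ℂ => L b) h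

theorem fderiv_tensorForm_succ {d k : ℕ} (v : (Fin (k + 1) → Fin d) → ℂ)
    (x b : EuclideanSpace ℂ (Fin d)) :
    fderiv ℂ (tensorForm v) x b =
      ∑ c, (b c * tensorForm (fun y => v (Fin.cons c y)) x +
        x c * fderiv ℂ (tensorForm fun y => v (Fin.cons c y)) x b) := by
  have hd : ∀ c, DifferentiableAt ℂ (fun x : EuclideanSpace ℂ (Fin d) => x c) x := fun c =>
    (contDiff_apply_euclidean c).differentiable (by norm_num) x
  have hd' : ∀ c, DifferentiableAt ℂ (tensorForm fun y => v (Fin.cons c y)) x := fun c =>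
    (contDiff_tensorForm _).differentiable (by norm_num) x
  have h : tensorForm v = fun x => ∑ c, x c * tensorForm (fun y => v (Fin.cons c y)) x :=
    funext (tensorForm_succ v)
  rw [h, fderiv_fun_sum fun c _ => (hd c).fun_mul (hd' c), sum_apply]
  refine Finset.sum_congr rfl fun c _ => ?_
  rw [fderiv_fun_mul (hd c) (hd' c)]
  simp only [add_apply, smul_apply, smul_eq_mul,
    fderiv_apply_euclidean]
  ring

theorem fderiv_tensorForm_zero {d : ℕ} (v : (Fin 0 → Fin d) → ℂ)
    (x b : EuclideanSpace ℂ (Fin d)) : fderiv ℂ (tensorForm v) x b = 0 := by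
  have h : tensorForm v = fun _ => v default := by
    funext x
    simp [tensorForm]
  simp [h]

/-- Euler's identity for homogeneous forms. -/
theorem fderiv_tensorForm_self {d k : ℕ} (v : (Fin k → Fin d) → ℂ)
    (x : EuclideanSpace ℂ (Fin d)) : fderiv ℂ (tensorForm v) x x = k * tensorForm v x := by
  induction k with
  | zero => simp [fderiv_tensorForm_zero]
  | succ k ih =>
    rw [fderiv_tensorForm_succ, tensorForm_succ, Finset.mul_sum]
    refine Finset.sum_congr rfl fun c _ => ?_
    rw [ih]
    push_cast
    ring

/-- Each of the `k + 1` slots contributes one term to the derivative, and symmetry moves the slot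
filled with `b` to the front, so all the terms agree. -/
theorem IsSymmTensor.fderiv_tensorForm {d k : ℕ} {v : (Fin (k + 1) → Fin d) → ℂ}
    (hv : IsSymmTensor v) (x : EuclideanSpace ℂ (Fin d)) (b : Fin d) :
    fderiv ℂ (tensorForm v) x (EuclideanSpace.single b 1) =
      (k + 1) * tensorForm (fun y => v (Fin.cons b y)) x := by
  induction k with
  | zero =>
    rw [fderiv_tensorForm_succ]
    simp [fderiv_tensorForm_zero]
  | succ k ih =>
    rw [fderiv_tensorForm_succ, Finset.sum_add_distrib]
    have h1 : ∑ c, (EuclideanSpace.single b (1 : ℂ)) c *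
        tensorForm (fun y => v (Fin.cons c y)) x = tensorForm (fun y => v (Fin.cons b y)) x := by
      simp
    have h2 : ∑ c, x c * fderiv ℂ (tensorForm fun y => v (Fin.cons c y)) x
        (EuclideanSpace.single b 1) = (k + 1) * tensorForm (fun y => v (Fin.cons b y)) x := by
      rw [tensorForm_succ (fun y => v (Fin.cons b y)), Finset.mul_sum]
      refine Finset.sum_congr rfl fun c _ => ?_
      rw [ih (hv.cons c)]
      simp only [hv.cons_cons_comm c b]
      ring
    rw [h1, h2]
    push_cast
    ring

end Forms

/-! ### The moments of a Haar random state -/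

section Moments

open scoped ComplexConjugate

/-- The average of `|ψ⟩⟨ψ|^{⊗k}` over Haar random states. -/
def haarMoment (d k : ℕ) [NeZero d] : Op d k :=
  matIntegral (haarState d) fun ψ => tensorPow (ketbra ψ) k

variable {d : ℕ}

theorem tensorPow_ketbra_apply (ψ : Ket d) {k : ℕ} (x y : Fin k → Fin d) :
    tensorPow (ketbra ψ) k x y = (∏ i, ψ.1 (x i)) * conj (∏ i, ψ.1 (y i)) := by
  simp [tensorPow, ketbra_apply, Finset.prod_mul_distrib]

theorem continuous_tensorPow_ketbra {k : ℕ} (x y : Fin k → Fin d) :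
    Continuous fun ψ : Ket d => tensorPow (ketbra ψ) k x y := by
  simp only [tensorPow_ketbra_apply]
  fun_prop

variable [NeZero d]

theorem haarMoment_mulVec_apply {k : ℕ} (v x) :
    (haarMoment d k *ᵥ v) x =
      ∫ ψ : Ket d, (∏ i, ψ.1 (x i)) * conj (tensorForm (fun y => conj (v y)) ψ.1)
        ∂haarState d := by
  have h : ∀ ψ : Ket d, (∏ i, ψ.1 (x i)) * conj (tensorForm (fun y => conj (v y)) ψ.1) =
      ∑ y, tensorPow (ketbra ψ) k x y * v y := by
    intro ψ
    simp only [tensorPow_ketbra_apply, tensorForm, map_sum, map_mul, Complex.conj_conj,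
      Finset.mul_sum]
    exact Finset.sum_congr rfl fun y _ => by ring
  simp only [h]
  rw [integral_finsetSum _ fun y _ =>
    integrable_haarState ((continuous_tensorPow_ketbra x y).fun_mul continuous_const)]
  simp only [integral_mul_const]
  rfl

omit [NeZero d] in
theorem prod_eq_tensorForm_single {k : ℕ} (x : Fin k → Fin d) (ψ : EuclideanSpace ℂ (Fin d)) :
    ∏ i, ψ (x i) = tensorForm (Pi.single x 1) ψ := by
  simp [tensorForm, Pi.single_apply]

/-- The moment operator acts on symmetric tensors as multiplication by a scalar. -/
theorem haarMoment_mulVec {k : ℕ} {v : (Fin k → Fin d) → ℂ} (hv : IsSymmTensor v) :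
    haarMoment d k *ᵥ v = ((k.factorial : ℂ) / d.ascFactorial k) • v := by
  induction k with
  | zero =>
    funext x
    rw [haarMoment_mulVec_apply]
    simp only [tensorForm, Finset.univ_unique, Finset.sum_singleton, Finset.univ_eq_empty,
      Finset.prod_empty, mul_one, one_mul, Complex.conj_conj, integral_const, probReal_univ,
      one_smul, Nat.factorial_zero, Nat.ascFactorial_zero, Nat.cast_one, div_one]
    exact congrArg v (Subsingleton.elim _ _)
  | succ k ih =>
    funext x
    obtain ⟨b, x, rfl⟩ : ∃ b y, x = Fin.cons b y := ⟨x 0, Fin.tail x, (Fin.cons_self_tail x).symm⟩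
    have hd : ((d : ℂ) + k) ≠ 0 := by
      have := NeZero.ne d
      exact_mod_cast (by omega : d + k ≠ 0)
    have hv' : IsSymmTensor fun y => conj (v y) := fun π y => by
      beta_reduce
      rw [hv π y]
    -- Splitting off the first coordinate `b` of the row index turns the left side into the moment
    -- of order `k + 1`. On the right, differentiation contracts `v` with `b`, leaving order `k`
    -- with ratio `(k + 1)/(d + k)`.
    have hp := integral_inner_mul (d := d) (contDiff_tensorForm (Pi.single x 1))
      (contDiff_tensorForm fun y => conj (v y)) (fderiv_tensorForm_self _)
      (EuclideanSpace.single b 1)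
    simp only [hv'.fderiv_tensorForm, ← prod_eq_tensorForm_single,
      EuclideanSpace.inner_single_left, map_one, one_mul, map_mul, map_add, map_natCast] at hp
    have hl : ∀ ψ : Ket d, (∏ i, ψ.1 (x i)) * (((k : ℂ) + 1) *
        conj (tensorForm (fun y => conj (v (Fin.cons b y))) ψ.1)) =
        ((k : ℂ) + 1) * ((∏ i, ψ.1 (x i)) *
          conj (tensorForm (fun y => conj (v (Fin.cons b y))) ψ.1)) := fun ψ => by ring
    simp only [hl, integral_const_mul] at hp
    rw [← haarMoment_mulVec_apply (fun y => v (Fin.cons b y)), ih (hv.cons b)] at hp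
    rw [haarMoment_mulVec_apply]
    simp only [Fin.prod_univ_succ, Fin.cons_zero, Fin.cons_succ]
    rw [← mul_right_inj' hd, hp, Nat.ascFactorial_succ, Nat.factorial_succ]
    simp only [Pi.smul_apply, smul_eq_mul]
    push_cast
    field_simp

end Moments

/-! ### The projector onto the symmetric subspace -/

section Projector

open scoped ComplexConjugate

variable {d : ℕ}

theorem permOp_mulVec {s : ℕ} (π : Equiv.Perm (Fin s)) (v : (Fin s → Fin d) → ℂ) :
    permOp d π *ᵥ v = fun x => v (x ∘ π) := by
  funext x
  have h : ∀ y : Fin s → Fin d, (x = fun i => y (π⁻¹ i)) ↔ x ∘ π = y := by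
    intro y
    constructor
    · rintro rfl
      funext i
      simp
    · rintro rfl
      funext i
      simp
  simp only [permOp, Matrix.mulVec, dotProduct, Matrix.of_apply, h]
  simp

theorem mem_symSubspace {s : ℕ} {v : EuclideanSpace ℂ (Fin s → Fin d)} :
    v ∈ symSubspace d s ↔ IsSymmTensor v.ofLp := by
  simp only [symSubspace, Submodule.mem_iInf, LinearMap.mem_eqLocus]
  refine forall_congr' fun π => ?_
  rw [← (WithLp.ofLp_injective 2).eq_iff]
  simp [Matrix.ofLp_toEuclideanCLM, permOp_mulVec, funext_iff]

theorem toEuclideanCLM_symProj (s : ℕ) :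
    Matrix.toEuclideanCLM (n := Fin s → Fin d) (𝕜 := ℂ) (symProj d s) =
      (symSubspace d s).starProjection :=
  StarAlgEquiv.apply_symm_apply _ _

theorem symProj_mul_self (s : ℕ) : symProj d s * symProj d s = symProj d s := by
  unfold symProj
  rw [← map_mul, (symSubspace d s).isIdempotentElem_starProjection.eq]

theorem isHermitian_symProj (s : ℕ) : (symProj d s).IsHermitian := by
  have h := (Matrix.toEuclideanCLM (n := Fin s → Fin d) (𝕜 := ℂ)).symm.map_star'
    (symSubspace d s).starProjection
  rw [(isSelfAdjoint_starProjection _).star_eq] at h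
  exact h.symm

theorem symProj_mulVec {s : ℕ} {v : (Fin s → Fin d) → ℂ} (hv : IsSymmTensor v) :
    symProj d s *ᵥ v = v := by
  have h := (symSubspace d s).starProjection_eq_self_iff.mpr
    ((mem_symSubspace (v := WithLp.toLp 2 v)).mpr hv)
  rw [← toEuclideanCLM_symProj] at h
  exact congrArg WithLp.ofLp h

theorem isSymmTensor_symProj_mulVec {s : ℕ} (v : (Fin s → Fin d) → ℂ) :
    IsSymmTensor (symProj d s *ᵥ v) := by
  have h := (symSubspace d s).starProjection_apply_mem (WithLp.toLp 2 v)
  rw [← toEuclideanCLM_symProj, mem_symSubspace] at h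
  exact h

theorem symProj_mul_of_col {s : ℕ} {A : Op d s} (hA : ∀ y, IsSymmTensor fun x => A x y) :
    symProj d s * A = A := by
  ext x y
  exact congrFun (symProj_mulVec (hA y)) x

theorem trace_symProj (s : ℕ) : (symProj d s).trace = symDim d s := by
  have h : LinearMap.IsProj (symSubspace d s) (symSubspace d s).starProjection.toLinearMap :=
    ⟨fun v => (symSubspace d s).starProjection_apply_mem v,
      fun v hv => (symSubspace d s).starProjection_eq_self_iff.mpr hv⟩
  have ht := h.trace
  rw [LinearMap.trace_eq_sum_inner _ (EuclideanSpace.basisFun (Fin s → Fin d) ℂ),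
    ← toEuclideanCLM_symProj] at ht
  rw [symDim, ← ht]
  refine Finset.sum_congr rfl fun x _ => ?_
  simp [EuclideanSpace.inner_single_left, Matrix.ofLp_toEuclideanCLM]

theorem isSymmTensor_tensorPow_ketbra_col (ψ : Ket d) {s : ℕ} (y : Fin s → Fin d) :
    IsSymmTensor fun x => tensorPow (ketbra ψ) s x y := by
  intro π x
  simp only [tensorPow_ketbra_apply, Function.comp_apply]
  rw [Equiv.prod_comp π fun i => ψ.1 (x i)]

theorem symProj_mul_tensorPow_ketbra (ψ : Ket d) (s : ℕ) :
    symProj d s * tensorPow (ketbra ψ) s = tensorPow (ketbra ψ) s :=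
  symProj_mul_of_col (isSymmTensor_tensorPow_ketbra_col ψ)

theorem trace_tensorPow (A : Matrix (Fin d) (Fin d) ℂ) (s : ℕ) :
    (tensorPow A s).trace = A.trace ^ s := by
  simp only [Matrix.trace, Matrix.diag, tensorPow, Matrix.of_apply]
  rw [Finset.sum_pow', Fintype.piFinset_univ]

theorem trace_ketbra (ψ : Ket d) : (ketbra ψ).trace = 1 := by
  rw [← sum_star_mul_self ψ]
  exact Finset.sum_congr rfl fun i _ => mul_comm _ _

theorem tensorPow_mul (A B : Matrix (Fin d) (Fin d) ℂ) (s : ℕ) :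
    tensorPow (A * B) s = tensorPow A s * tensorPow B s := by
  ext x y
  simp only [Matrix.mul_apply, tensorPow, Matrix.of_apply, ← Finset.prod_mul_distrib]
  rw [Finset.prod_univ_sum, Fintype.piFinset_univ]

variable [NeZero d]

theorem symProj_mul_haarMoment (s : ℕ) : symProj d s * haarMoment d s = haarMoment d s := by
  refine symProj_mul_of_col fun y π x => ?_
  change ∫ ψ, _ ∂haarState d = ∫ ψ, _ ∂haarState d
  exact integral_congr_ae (Filter.Eventually.of_forall fun ψ =>
    isSymmTensor_tensorPow_ketbra_col ψ y π x)

theorem isHermitian_haarMoment (s : ℕ) : (haarMoment d s).IsHermitian := by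
  ext x y
  change conj (∫ ψ, tensorPow (ketbra ψ) s y x ∂haarState d) =
    ∫ ψ, tensorPow (ketbra ψ) s x y ∂haarState d
  rw [← integral_conj]
  refine integral_congr_ae (Filter.Eventually.of_forall fun ψ => ?_)
  simp only [tensorPow_ketbra_apply, map_mul, Complex.conj_conj]
  ring

/-- The columns of the projector are symmetric tensors, so the eigenvalue formula applies to each of
them. -/
theorem haarMoment_mul_symProj (s : ℕ) :
    haarMoment d s * symProj d s =
      ((s.factorial : ℂ) / d.ascFactorial s) • symProj d s := by
  ext x y
  refine congrFun (haarMoment_mulVec (v := fun z => symProj d s z y) ?_) x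
  have := isSymmTensor_symProj_mulVec (d := d) (Pi.single y 1)
  rwa [Matrix.mulVec_single_one] at this

/-- The moment operator is Hermitian with symmetric columns, so it absorbs the projector on either
side and is determined by its action on the symmetric subspace. -/
theorem haarMoment_eq (s : ℕ) :
    haarMoment d s = ((s.factorial : ℂ) / d.ascFactorial s) • symProj d s := by
  rw [← haarMoment_mul_symProj, ← Matrix.conjTranspose_inj, Matrix.conjTranspose_mul,
    (isHermitian_haarMoment s).eq, (isHermitian_symProj s).eq, symProj_mul_haarMoment]

theorem trace_haarMoment (s : ℕ) : (haarMoment d s).trace = 1 := by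
  simp only [Matrix.trace, Matrix.diag, haarMoment, matIntegral, Matrix.of_apply]
  rw [← integral_finsetSum _ fun x _ => integrable_haarState (continuous_tensorPow_ketbra x x)]
  have h : ∀ ψ : Ket d, ∑ x, tensorPow (ketbra ψ) s x x = 1 := fun ψ => by
    have := trace_tensorPow (ketbra ψ) s
    rwa [trace_ketbra, one_pow] at this
  simp [h]

/-- The dimension of the symmetric subspace of `(ℂ^d)^{⊗s}`. -/
theorem symDim_eq (s : ℕ) : (symDim d s : ℂ) = d.ascFactorial s / s.factorial := by
  have h := trace_haarMoment (d := d) s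
  rw [haarMoment_eq, Matrix.trace_smul, trace_symProj, smul_eq_mul] at h
  have h1 : (s.factorial : ℂ) ≠ 0 := by exact_mod_cast s.factorial_ne_zero
  -- If the denominator vanished, division by zero would make the trace zero rather than one.
  have h2 : (d.ascFactorial s : ℂ) ≠ 0 := by
    intro h0
    simp [h0] at h
  field_simp at h ⊢
  linear_combination h

theorem symDim_ne_zero (s : ℕ) : (symDim d s : ℂ) ≠ 0 := by
  intro h0
  have h := trace_haarMoment (d := d) s
  rw [haarMoment_eq, Matrix.trace_smul, trace_symProj, h0, smul_zero] at h
  exact zero_ne_one h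

/-- The moment operator of a Haar random state is the normalized symmetric projector. -/
theorem symDim_smul_haarMoment (s : ℕ) : (symDim d s : ℂ) • haarMoment d s = symProj d s := by
  have h : ((s.factorial : ℂ) / d.ascFactorial s) = (symDim d s : ℂ)⁻¹ := by
    rw [symDim_eq, inv_div]
  rw [haarMoment_eq, h, smul_smul, mul_inv_cancel₀ (symDim_ne_zero s), one_smul]

end Projector

/-! ### Moments weighted by a power of a linear form -/

section Weighted

open scoped ComplexConjugate

variable {d : ℕ}

theorem contDiff_inner_right (u : EuclideanSpace ℂ (Fin d)) :
    ContDiff ℂ 1 fun x : EuclideanSpace ℂ (Fin d) => (inner ℂ u x : ℂ) :=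
  (innerSL ℂ u).contDiff

theorem hasFDerivAt_inner_right (u x : EuclideanSpace ℂ (Fin d)) :
    HasFDerivAt (fun x : EuclideanSpace ℂ (Fin d) => (inner ℂ u x : ℂ)) (innerSL ℂ u) x :=
  (innerSL ℂ u).hasFDerivAt

theorem contDiff_inner_pow (φ : EuclideanSpace ℂ (Fin d)) (s : ℕ) :
    ContDiff ℂ 1 fun x : EuclideanSpace ℂ (Fin d) => (inner ℂ φ x : ℂ) ^ s :=
  (contDiff_inner_right φ).pow s

theorem fderiv_inner_pow (φ x v : EuclideanSpace ℂ (Fin d)) (s : ℕ) :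
    fderiv ℂ (fun x : EuclideanSpace ℂ (Fin d) => (inner ℂ φ x : ℂ) ^ s) x v =
      s * inner ℂ φ v * inner ℂ φ x ^ (s - 1) := by
  rw [((hasFDerivAt_inner_right φ x).pow s).fderiv]
  simp only [smul_apply, innerSL_apply_apply, smul_eq_mul, nsmul_eq_mul]
  ring

theorem contDiff_inner_mul {g : EuclideanSpace ℂ (Fin d) → ℂ} (hg : ContDiff ℂ 1 g)
    (a : EuclideanSpace ℂ (Fin d)) : ContDiff ℂ 1 fun x => inner ℂ a x * g x :=
  (contDiff_inner_right a).mul hg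

theorem fderiv_inner_mul {g : EuclideanSpace ℂ (Fin d) → ℂ} (hg : ContDiff ℂ 1 g)
    (a x v : EuclideanSpace ℂ (Fin d)) :
    fderiv ℂ (fun x => inner ℂ a x * g x) x v =
      inner ℂ a v * g x + inner ℂ a x * fderiv ℂ g x v := by
  rw [((hasFDerivAt_inner_right a x).fun_mul
    (hg.differentiable (by norm_num) x).hasFDerivAt).fderiv]
  simp
  ring

theorem fderiv_inner_pow_self (φ x : EuclideanSpace ℂ (Fin d)) (s : ℕ) :
    fderiv ℂ (fun x : EuclideanSpace ℂ (Fin d) => (inner ℂ φ x : ℂ) ^ s) x x =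
      s * inner ℂ φ x ^ s := by
  rw [fderiv_inner_pow]
  cases s with
  | zero => simp
  | succ s => rw [Nat.add_sub_cancel, pow_succ]; ring

theorem fderiv_inner_mul_self {g : EuclideanSpace ℂ (Fin d) → ℂ} (hg : ContDiff ℂ 1 g) {k : ℕ}
    (hk : ∀ x, fderiv ℂ g x x = k * g x) (a x : EuclideanSpace ℂ (Fin d)) :
    fderiv ℂ (fun x => inner ℂ a x * g x) x x = (k + 1 : ℕ) * (inner ℂ a x * g x) := by
  rw [fderiv_inner_mul hg, hk]
  push_cast
  ring

variable [NeZero d]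

/-- The sesquilinear pairing of functions of a Haar random state. -/
def haarPairing (g h : EuclideanSpace ℂ (Fin d) → ℂ) : ℂ :=
  ∫ ψ : Ket d, g ψ.1 * conj (h ψ.1) ∂haarState d

theorem conj_haarPairing (g h : EuclideanSpace ℂ (Fin d) → ℂ) :
    conj (haarPairing g h) = haarPairing h g := by
  rw [haarPairing, ← integral_conj]
  refine integral_congr_ae (Filter.Eventually.of_forall fun ψ => ?_)
  simp only [map_mul, Complex.conj_conj]
  ring

theorem haarPairing_inner_mul {g h : EuclideanSpace ℂ (Fin d) → ℂ}
    (hg : ContDiff ℂ 1 g) (hh : ContDiff ℂ 1 h) {k : ℕ}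
    (hk : ∀ x, fderiv ℂ g x x = k * g x) (b : EuclideanSpace ℂ (Fin d)) :
    ((d : ℂ) + k) * haarPairing (fun x => inner ℂ b x * g x) h =
      haarPairing g fun x => fderiv ℂ h x b :=
  integral_inner_mul hg hh hk b

theorem haarPairing_const_mul_right (g h : EuclideanSpace ℂ (Fin d) → ℂ) (c : ℂ) :
    haarPairing g (fun x => c * h x) = conj c * haarPairing g h := by
  simp only [haarPairing, map_mul]
  rw [← integral_const_mul]
  exact integral_congr_ae (Filter.Eventually.of_forall fun ψ => by ring_nf)

theorem haarPairing_add_right {g h h' : EuclideanSpace ℂ (Fin d) → ℂ} (hg : ContDiff ℂ 1 g)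
    (hh : ContDiff ℂ 1 h) (hh' : ContDiff ℂ 1 h') :
    haarPairing g (fun x => h x + h' x) = haarPairing g h + haarPairing g h' := by
  have hg := hg.continuous
  have hh := hh.continuous
  have hh' := hh'.continuous
  simp only [haarPairing, map_add, mul_add]
  exact integral_add (integrable_haarState (by fun_prop)) (integrable_haarState (by fun_prop))

theorem natCast_add_ne_zero (s : ℕ) : ((d : ℂ) + s) ≠ 0 := by
  have := NeZero.ne d
  exact_mod_cast (by omega : d + s ≠ 0)

/-- The moments of the transition probability. -/
def overlapMoment (φ : EuclideanSpace ℂ (Fin d)) (s : ℕ) : ℂ :=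
  haarPairing (fun x => inner ℂ φ x ^ s) (fun x => inner ℂ φ x ^ s)

theorem haarPairing_inner_pow_one (φ a : EuclideanSpace ℂ (Fin d)) (s : ℕ) :
    ((d : ℂ) + s) * haarPairing (fun x => inner ℂ a x * inner ℂ φ x ^ s)
      (fun x => inner ℂ φ x ^ (s + 1)) = (s + 1) * inner ℂ a φ * overlapMoment φ s := by
  rw [haarPairing_inner_mul (contDiff_inner_pow φ s) (contDiff_inner_pow φ (s + 1))
    (fun x => fderiv_inner_pow_self φ x s)]
  simp only [fderiv_inner_pow, Nat.add_sub_cancel]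
  rw [haarPairing_const_mul_right]
  simp [overlapMoment]

/-- This recursion, the case `a = φ` of the preceding identity, is what allows the factors `d + s`
to be cancelled in the pairings below. -/
theorem overlapMoment_succ (φ : Ket d) (s : ℕ) :
    ((d : ℂ) + s) * overlapMoment φ.1 (s + 1) = (s + 1) * overlapMoment φ.1 s := by
  have h := haarPairing_inner_pow_one φ.1 φ.1 s
  have hφ : (inner ℂ φ.1 φ.1 : ℂ) = 1 := by
    rw [inner_self_eq_norm_sq_to_K, norm_eq_of_mem_sphere]; simp
  rw [hφ, mul_one] at h
  rw [← h, overlapMoment]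
  simp only [pow_succ']

/-- Differentiating a power of `⟨φ,·⟩` along `a` sees only the component of `a` along `φ`, so
`⟨a,·⟩` may be replaced by `⟨a,φ⟩⟨φ,·⟩`. -/
theorem haarPairing_one_zero (φ : Ket d) (a : EuclideanSpace ℂ (Fin d)) (s : ℕ) :
    haarPairing (fun x => inner ℂ a x * inner ℂ φ.1 x ^ s) (fun x => inner ℂ φ.1 x ^ (s + 1)) =
      inner ℂ a φ.1 * overlapMoment φ.1 (s + 1) := by
  rw [← mul_right_inj' (natCast_add_ne_zero (d := d) s), haarPairing_inner_pow_one]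
  linear_combination (-inner ℂ a φ.1) * overlapMoment_succ φ s

theorem haarPairing_zero_one (φ : Ket d) (b : EuclideanSpace ℂ (Fin d)) (s : ℕ) :
    haarPairing (fun x => inner ℂ φ.1 x ^ (s + 1)) (fun x => inner ℂ b x * inner ℂ φ.1 x ^ s) =
      inner ℂ φ.1 b * conj (overlapMoment φ.1 (s + 1)) := by
  rw [← conj_haarPairing, haarPairing_one_zero, map_mul, inner_conj_symm]

theorem conj_overlapMoment (φ : EuclideanSpace ℂ (Fin d)) (s : ℕ) :
    conj (overlapMoment φ s) = overlapMoment φ s := conj_haarPairing _ _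

theorem haarPairing_one_one (φ : Ket d) (a b : EuclideanSpace ℂ (Fin d)) (s : ℕ) :
    ((d : ℂ) + s) * haarPairing (fun x => inner ℂ a x * inner ℂ φ.1 x ^ s)
      (fun x => inner ℂ b x * inner ℂ φ.1 x ^ s) =
      (inner ℂ a b + s * (inner ℂ a φ.1 * inner ℂ φ.1 b)) * overlapMoment φ.1 s := by
  have hp := contDiff_inner_pow φ.1
  rw [haarPairing_inner_mul (hp s) (contDiff_inner_mul (hp s) b)
    (fun x => fderiv_inner_pow_self φ.1 x s)]
  simp only [fderiv_inner_mul (hp s), fderiv_inner_pow]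
  have h : ∀ x : EuclideanSpace ℂ (Fin d),
      inner ℂ b x * ((s : ℂ) * inner ℂ φ.1 a * inner ℂ φ.1 x ^ (s - 1)) =
      (s * inner ℂ φ.1 a) * (inner ℂ b x * inner ℂ φ.1 x ^ (s - 1)) := fun x => by ring
  simp only [h]
  rw [haarPairing_add_right (hp s) (contDiff_const.mul (hp s))
    (contDiff_const.mul (contDiff_inner_mul (hp _) b)), haarPairing_const_mul_right,
    haarPairing_const_mul_right, map_mul, inner_conj_symm, inner_conj_symm, Complex.conj_natCast]
  -- For `s = 0` the exponent `s - 1` truncates to `0`, but its term carries a factor `s`.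
  cases s with
  | zero => simp [overlapMoment]
  | succ s =>
    rw [Nat.add_sub_cancel, haarPairing_zero_one, conj_overlapMoment, overlapMoment]
    ring

theorem haarPairing_two_zero (φ : Ket d) (a c : EuclideanSpace ℂ (Fin d)) (s : ℕ) :
    haarPairing (fun x => inner ℂ a x * (inner ℂ c x * inner ℂ φ.1 x ^ s))
      (fun x => inner ℂ φ.1 x ^ (s + 2)) =
      inner ℂ a φ.1 * inner ℂ c φ.1 * overlapMoment φ.1 (s + 2) := by
  have hp := contDiff_inner_pow φ.1
  rw [← mul_right_inj' (natCast_add_ne_zero (d := d) (s + 1)),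
    haarPairing_inner_mul (contDiff_inner_mul (hp s) c) (hp (s + 2))
    (fderiv_inner_mul_self (hp s) (fun x => fderiv_inner_pow_self φ.1 x s) c)]
  simp only [fderiv_inner_pow, show s + 2 - 1 = s + 1 from rfl]
  rw [haarPairing_const_mul_right, haarPairing_one_zero, map_mul, inner_conj_symm,
    Complex.conj_natCast]
  have h := overlapMoment_succ φ (s + 1)
  push_cast at h ⊢
  linear_combination (-inner ℂ a φ.1 * inner ℂ c φ.1) * h

/-- Expansion of the pairing with a product of two linear forms and a power. -/
theorem haarPairing_inner_mul_two (φ a b c : EuclideanSpace ℂ (Fin d)) (s : ℕ)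
    {g : EuclideanSpace ℂ (Fin d) → ℂ} (hg : ContDiff ℂ 1 g) {k : ℕ}
    (hk : ∀ x, fderiv ℂ g x x = k * g x) :
    ((d : ℂ) + k) * haarPairing (fun x => inner ℂ a x * g x)
      (fun x => inner ℂ b x * (inner ℂ c x * inner ℂ φ x ^ s)) =
      inner ℂ a b * haarPairing g (fun x => inner ℂ c x * inner ℂ φ x ^ s) +
      inner ℂ a c * haarPairing g (fun x => inner ℂ b x * inner ℂ φ x ^ s) +
      s * inner ℂ a φ *
        haarPairing g (fun x => inner ℂ b x * (inner ℂ c x * inner ℂ φ x ^ (s - 1))) := by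
  have hp := contDiff_inner_pow φ
  rw [haarPairing_inner_mul hg (contDiff_inner_mul (contDiff_inner_mul (hp s) c) b) hk]
  have h : ∀ x : EuclideanSpace ℂ (Fin d),
      fderiv ℂ (fun x => inner ℂ b x * (inner ℂ c x * inner ℂ φ x ^ s)) x a =
      (inner ℂ b a * (inner ℂ c x * inner ℂ φ x ^ s) +
        inner ℂ c a * (inner ℂ b x * inner ℂ φ x ^ s)) +
      (s * inner ℂ φ a) * (inner ℂ b x * (inner ℂ c x * inner ℂ φ x ^ (s - 1))) := by
    intro x
    rw [fderiv_inner_mul (contDiff_inner_mul (hp s) c), fderiv_inner_mul (hp s), fderiv_inner_pow]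
    ring
  simp only [h]
  have h1 := contDiff_inner_mul (hp s) c
  have h2 := contDiff_inner_mul (hp s) b
  have h3 := contDiff_inner_mul (contDiff_inner_mul (hp (s - 1)) c) b
  rw [haarPairing_add_right hg ((contDiff_const.mul h1).add (contDiff_const.mul h2))
    (contDiff_const.mul h3), haarPairing_add_right hg (contDiff_const.mul h1)
    (contDiff_const.mul h2), haarPairing_const_mul_right, haarPairing_const_mul_right,
    haarPairing_const_mul_right, map_mul, inner_conj_symm, inner_conj_symm, inner_conj_symm,
    Complex.conj_natCast]

/-- This supplies the remainder term in the integration by parts for `haarPairing_two_two`, where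
differentiating the power lowers its exponent by one. -/
theorem haarPairing_one_two (φ : Ket d) (a b c : EuclideanSpace ℂ (Fin d)) (s : ℕ) :
    ((d : ℂ) + (s + 1 : ℕ)) * haarPairing (fun x => inner ℂ a x * inner ℂ φ.1 x ^ (s + 1))
      (fun x => inner ℂ b x * (inner ℂ c x * inner ℂ φ.1 x ^ s)) =
      (inner ℂ a b * inner ℂ φ.1 c + inner ℂ a c * inner ℂ φ.1 b +
        s * (inner ℂ a φ.1 * inner ℂ φ.1 b * inner ℂ φ.1 c)) * overlapMoment φ.1 (s + 1) := by
  rw [haarPairing_inner_mul_two φ.1 a b c s (contDiff_inner_pow φ.1 (s + 1))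
    (fun x => fderiv_inner_pow_self φ.1 x (s + 1)), haarPairing_zero_one, haarPairing_zero_one,
    conj_overlapMoment]
  cases s with
  | zero =>
    simp
    ring
  | succ s =>
    rw [Nat.add_sub_cancel, ← conj_haarPairing (fun x =>
      inner ℂ b x * (inner ℂ c x * inner ℂ φ.1 x ^ s)), haarPairing_two_zero, map_mul, map_mul,
      inner_conj_symm, inner_conj_symm, conj_overlapMoment]
    ring

/-- Integrating by parts in `a` lets it hit `b`, `b'` or one of the `s` copies of `φ`; each
remaining pairing is already known. The two products overcount the terms with all four vectors
paired with `φ`, giving `2s²` in place of `s(s - 1)`; the last term corrects this. -/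
theorem haarPairing_two_two (φ : Ket d) (a a' b b' : EuclideanSpace ℂ (Fin d)) (s : ℕ) :
    ((d : ℂ) + s) * ((d : ℂ) + s + 1) *
      haarPairing (fun x => inner ℂ a x * (inner ℂ a' x * inner ℂ φ.1 x ^ s))
        (fun x => inner ℂ b x * (inner ℂ b' x * inner ℂ φ.1 x ^ s)) =
      ((inner ℂ a b + s * (inner ℂ a φ.1 * inner ℂ φ.1 b)) *
          (inner ℂ a' b' + s * (inner ℂ a' φ.1 * inner ℂ φ.1 b')) +
        (inner ℂ a b' + s * (inner ℂ a φ.1 * inner ℂ φ.1 b')) *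
          (inner ℂ a' b + s * (inner ℂ a' φ.1 * inner ℂ φ.1 b)) -
        s * (s + 1) * (inner ℂ a φ.1 * inner ℂ a' φ.1 * inner ℂ φ.1 b * inner ℂ φ.1 b')) *
      overlapMoment φ.1 s := by
  have h0 := haarPairing_inner_mul_two φ.1 a b b' s
    (contDiff_inner_mul (contDiff_inner_pow φ.1 s) a')
    (fderiv_inner_mul_self (contDiff_inner_pow φ.1 s)
      (fun x => fderiv_inner_pow_self φ.1 x s) a')
  have h1 := haarPairing_one_one φ a' b' s
  have h2 := haarPairing_one_one φ a' b s
  cases s with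
  | zero =>
    push_cast at h0 h1 h2 ⊢
    linear_combination ((d : ℂ) + 0) * h0 + inner ℂ a b * h1 + inner ℂ a b' * h2
  | succ s =>
    have h3 := haarPairing_one_two φ a' b b' s
    rw [Nat.add_sub_cancel] at h0
    push_cast at h0 h1 h2 h3 ⊢
    linear_combination ((d : ℂ) + (s + 1)) * h0 + inner ℂ a b * h1 + inner ℂ a b' * h2 +
      (s + 1) * inner ℂ a φ.1 * h3

end Weighted

/-! ### The standard symmetric joint measurement -/

section Measurement

open scoped ComplexConjugate

open scoped ComplexOrder in
theorem posSemidef_matIntegral {Ω n : Type*} [MeasurableSpace Ω] [Fintype n] (μ : Measure Ω)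
    {F : Ω → Matrix n n ℂ} (hF : ∀ ω, (F ω).PosSemidef)
    (hi : ∀ i j, Integrable (fun ω => F ω i j) μ) : (matIntegral μ F).PosSemidef := by
  refine Matrix.PosSemidef.of_dotProduct_mulVec_nonneg ?_ fun v => ?_
  · ext i j
    change conj (∫ ω, F ω j i ∂μ) = ∫ ω, F ω i j ∂μ
    rw [← integral_conj]
    exact integral_congr_ae (Filter.Eventually.of_forall fun ω => (hF ω).isHermitian.apply i j)
  · have h : star v ⬝ᵥ (matIntegral μ F *ᵥ v) = ∫ ω, star v ⬝ᵥ (F ω *ᵥ v) ∂μ := by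
      simp only [dotProduct, Matrix.mulVec, matIntegral, Matrix.of_apply]
      rw [integral_finsetSum _ fun i _ => (integrable_finsetSum _ fun j _ =>
        (hi i j).mul_const _).const_mul _]
      refine Finset.sum_congr rfl fun i _ => ?_
      rw [integral_const_mul, integral_finsetSum _ fun j _ => (hi i j).mul_const _]
      simp only [integral_mul_const]
    rw [h]
    exact integral_nonneg fun ω => (hF ω).dotProduct_mulVec_nonneg v

variable {d : ℕ}

open scoped ComplexOrder in
theorem posSemidef_tensorPow_ketbra (ψ : Ket d) (s : ℕ) :
    (tensorPow (ketbra ψ) s).PosSemidef := by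
  have h : tensorPow (ketbra ψ) s = Matrix.vecMulVec (fun x => ∏ i, ψ.1 (x i))
      (star fun x => ∏ i, ψ.1 (x i)) := by
    ext x y
    rw [tensorPow_ketbra_apply]
    rfl
  rw [h]
  exact Matrix.posSemidef_vecMulVec_self_star _

open scoped ComplexOrder in
theorem posSemidef_one_sub_symProj (s : ℕ) : (1 - symProj d s).PosSemidef := by
  have h : 1 - symProj d s = (1 - symProj d s)ᴴ * (1 - symProj d s) := by
    rw [Matrix.conjTranspose_sub, Matrix.conjTranspose_one, (isHermitian_symProj s).eq, mul_sub,
      mul_one, sub_mul, symProj_mul_self, one_mul, sub_self, sub_zero]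
  rw [h]
  exact Matrix.posSemidef_conjTranspose_mul_self _

variable [NeZero d]

theorem integrable_smul_tensorPow_ketbra {s : ℕ} (A : Set (Ket d)) (c : ℂ) (x y) :
    Integrable (fun ψ => (c • tensorPow (ketbra ψ) s) x y) ((haarState d).restrict A) :=
  ((integrable_haarState (continuous_tensorPow_ketbra x y)).const_mul c).integrableOn

open Classical in
open scoped ComplexOrder in
/-- The standard symmetric joint measurement is a POVM. -/
theorem isPOVM_symMeasurement (s : ℕ) : IsPOVM (symMeasurement d s) where
  posSemidef E _ := by
    have hc : (0 : ℂ) ≤ symDim d s := Nat.cast_nonneg _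
    refine (posSemidef_matIntegral _ (fun ψ => (posSemidef_tensorPow_ketbra ψ s).smul hc)
      (integrable_smul_tensorPow_ketbra _ _)).add ?_
    split_ifs
    · exact posSemidef_one_sub_symProj s
    · exact Matrix.PosSemidef.zero
  iUnion E hE hd := by
    refine HasSum.add ?_ ?_
    · refine Pi.hasSum.2 fun x => Pi.hasSum.2 fun y => ?_
      rw [Set.preimage_iUnion]
      exact hasSum_integral_iUnion (fun k => measurable_inl (hE k))
        (fun k l hkl => (hd hkl).preimage _) (integrable_smul_tensorPow_ketbra _ _ x y)
    · by_cases h : ∃ k, Sum.inr () ∈ E k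
      · obtain ⟨k, hk⟩ := h
        have hs := hasSum_single (f := fun l => if Sum.inr () ∈ E l then 1 - symProj d s else 0) k
          fun l hl => if_neg fun hl' => Set.disjoint_left.mp (hd hl) hl' hk
        rw [if_pos (Set.mem_iUnion.2 ⟨k, hk⟩)]
        rwa [if_pos hk] at hs
      · have h' : ∀ k, Sum.inr () ∉ E k := not_exists.mp h
        rw [if_neg (by simpa using h')]
        simp only [if_neg (h' _)]
        exact hasSum_zero
  univ := by
    -- Completeness is the moment formula: the pure-state elements add up to the symmetric
    -- projector, which the "fail" element complements.
    have h : matIntegral ((haarState d).restrict (Sum.inl ⁻¹' (Set.univ : Set (Outcome d))))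
        (fun ψ => (symDim d s : ℂ) • tensorPow (ketbra ψ) s) = symProj d s := by
      rw [← symDim_smul_haarMoment, Set.preimage_univ, Measure.restrict_univ]
      ext x y
      exact integral_const_mul _ _
    rw [symMeasurement, h, if_pos (Set.mem_univ _), add_sub_cancel]

/-! ### The law of the outcome -/

/-- The transition probability `|⟨φ|ψ⟩|²`. -/
def overlap (φ ψ : Ket d) : ℝ := ‖(inner ℂ φ.1 ψ.1 : ℂ)‖ ^ 2

omit [NeZero d] in
theorem overlap_nonneg (φ ψ : Ket d) : 0 ≤ overlap φ ψ := sq_nonneg _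

omit [NeZero d] in
theorem continuous_overlap (φ : Ket d) : Continuous (overlap φ) := by
  unfold overlap
  fun_prop

omit [NeZero d] in
theorem ofReal_overlap (φ ψ : Ket d) :
    (overlap φ ψ : ℂ) = inner ℂ φ.1 ψ.1 * conj (inner ℂ φ.1 ψ.1 : ℂ) := by
  rw [RCLike.mul_conj, overlap]
  push_cast
  rfl

omit [NeZero d] in
theorem trace_ketbra_mul_ketbra (φ ψ : Ket d) : (ketbra ψ * ketbra φ).trace = overlap φ ψ := by
  rw [ofReal_overlap, PiLp.inner_apply, map_sum, Finset.sum_mul_sum]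
  simp only [Matrix.trace, Matrix.diag, Matrix.mul_apply, ketbra_apply, RCLike.inner_apply,
    map_mul, Complex.conj_conj, Complex.star_def]
  exact Finset.sum_congr rfl fun i _ => Finset.sum_congr rfl fun j _ => by ring

open Classical in
-- The "fail" element annihilates `|φ⟩⟨φ|^{⊗s}`, and `tr (A^{⊗s} B^{⊗s}) = (tr AB)^s` turns the rest
-- into an integral of overlaps.
theorem trace_symMeasurement_mul (s : ℕ) (φ : Ket d) (E : Set (Outcome d)) :
    (symMeasurement d s E * tensorPow (ketbra φ) s).trace =
      ((∫ ψ in Sum.inl ⁻¹' E, symDim d s * overlap φ ψ ^ s ∂haarState d : ℝ) : ℂ) := by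
  have h0 : ((if Sum.inr () ∈ E then 1 - symProj d s else 0 : Op d s) *
      tensorPow (ketbra φ) s) = 0 := by
    split_ifs
    · rw [sub_mul, one_mul, symProj_mul_tensorPow_ketbra, sub_self]
    · rw [zero_mul]
  have h1 : ∀ ψ, ((symDim d s * overlap φ ψ ^ s : ℝ) : ℂ) =
      ∑ x, ∑ y, ((symDim d s : ℂ) • tensorPow (ketbra ψ) s) x y * tensorPow (ketbra φ) s y x := by
    intro ψ
    push_cast
    rw [← trace_ketbra_mul_ketbra, ← trace_tensorPow, tensorPow_mul, ← smul_eq_mul,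
      ← Matrix.trace_smul, ← Matrix.smul_mul]
    rfl
  have hi := integrable_smul_tensorPow_ketbra (d := d) (s := s) (Sum.inl ⁻¹' E) (symDim d s)
  rw [symMeasurement, add_mul, h0, add_zero, ← integral_complex_ofReal]
  simp only [h1]
  rw [integral_finsetSum _ fun x _ => integrable_finsetSum _ fun y _ => (hi x y).mul_const _]
  refine Finset.sum_congr rfl fun x _ => ?_
  rw [integral_finsetSum _ fun y _ => (hi x y).mul_const _]
  simp only [integral_mul_const]
  rfl

theorem measurableEmbedding_inl {α β : Type*} [MeasurableSpace α] [MeasurableSpace β] :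
    MeasurableEmbedding (Sum.inl : α → α ⊕ β) :=
  ⟨Sum.inl_injective, measurable_inl, fun _ hs => measurableSet_inl_image.2 hs⟩

/-- The law of the outcome of the symmetric joint measurement on `|φ⟩⟨φ|^{⊗s}`. -/
def bornLaw (s : ℕ) (φ : Ket d) : Measure (Outcome d) :=
  ((haarState d).withDensity fun ψ => ENNReal.ofReal (symDim d s * overlap φ ψ ^ s)).map Sum.inl

omit [NeZero d] in
theorem continuous_symDim_mul_overlap_pow (s : ℕ) (φ : Ket d) :
    Continuous fun ψ => (symDim d s : ℝ) * overlap φ ψ ^ s :=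
  continuous_const.mul ((continuous_overlap φ).pow s)

theorem bornLaw_real (s : ℕ) (φ : Ket d) {E : Set (Outcome d)} (hE : MeasurableSet E) :
    (bornLaw s φ).real E = ∫ ψ in Sum.inl ⁻¹' E, symDim d s * overlap φ ψ ^ s ∂haarState d := by
  have hc := continuous_symDim_mul_overlap_pow s φ
  rw [measureReal_def, bornLaw, Measure.map_apply measurable_inl hE,
    withDensity_apply _ (measurable_inl hE), integral_eq_lintegral_of_nonneg_ae
      (Filter.Eventually.of_forall fun ψ => by
        have := overlap_nonneg φ ψ
        positivity) hc.aestronglyMeasurable]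

theorem bornLaw_real_eq_trace (s : ℕ) (φ : Ket d) {E : Set (Outcome d)} (hE : MeasurableSet E) :
    (((bornLaw s φ).real E : ℝ) : ℂ) =
      (symMeasurement d s E * tensorPow (ketbra φ) s).trace := by
  rw [trace_symMeasurement_mul, bornLaw_real s φ hE]

theorem isOutcomeLaw_bornLaw (s : ℕ) (φ : Ket d) :
    IsOutcomeLaw (symMeasurement d s) (tensorPow (ketbra φ) s) (bornLaw s φ) := by
  refine ⟨⟨?_⟩, fun E hE => bornLaw_real_eq_trace s φ hE⟩
  -- The total mass is read off from completeness of the POVM and the unit trace of the state,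
  -- without evaluating the overlap integral.
  have h := bornLaw_real_eq_trace s φ (MeasurableSet.univ (α := Outcome d))
  rw [(isPOVM_symMeasurement s).univ, one_mul, trace_tensorPow, trace_ketbra, one_pow] at h
  have h' : ((bornLaw s φ) Set.univ).toReal = 1 := by exact_mod_cast h
  exact (ENNReal.toReal_eq_one_iff _).mp h'

theorem IsOutcomeLaw.unique {Y n : Type*} [MeasurableSpace Y] [Fintype n]
    {M : Set Y → Matrix n n ℂ} {σ : Matrix n n ℂ} {P Q : Measure Y} (hP : IsOutcomeLaw M σ P)
    (hQ : IsOutcomeLaw M σ Q) : P = Q := by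
  have := hP.1
  have := hQ.1
  ext E hE
  have h := (hP.2 E hE).trans (hQ.2 E hE).symm
  exact (measureReal_eq_measureReal_iff).mp (by exact_mod_cast h)

theorem bornLaw_inr (s : ℕ) (φ : Ket d) : bornLaw s φ {Sum.inr ()} = 0 := by
  have hm : MeasurableSet ({Sum.inr ()} : Set (Outcome d)) := by
    rw [← Set.image_singleton]
    exact (MeasurableSet.singleton ()).inr_image
  rw [bornLaw, Measure.map_apply measurable_inl hm]
  have h : (Sum.inl ⁻¹' {Sum.inr ()} : Set (Ket d)) = ∅ := by
    ext
    simp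
  rw [h, measure_empty]

theorem integral_bornLaw (s : ℕ) (φ : Ket d) (F : Outcome d → ℂ) :
    ∫ y, F y ∂bornLaw s φ =
      symDim d s * ∫ ψ, F (Sum.inl ψ) * (overlap φ ψ : ℂ) ^ s ∂haarState d := by
  rw [bornLaw, measurableEmbedding_inl.integral_map,
    integral_withDensity_eq_integral_toReal_smul
      (continuous_symDim_mul_overlap_pow s φ).measurable.ennreal_ofReal
      (Filter.Eventually.of_forall fun _ => ENNReal.ofReal_lt_top), ← integral_const_mul]
  refine integral_congr_ae (Filter.Eventually.of_forall fun ψ => ?_)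
  have h : 0 ≤ (symDim d s : ℝ) * overlap φ ψ ^ s := by
    have := overlap_nonneg φ ψ
    positivity
  simp only [ENNReal.toReal_ofReal h, Complex.real_smul]
  push_cast
  ring

theorem integrable_bornLaw (s : ℕ) (φ : Ket d) {F : Outcome d → ℂ}
    (hF : Continuous fun ψ => F (Sum.inl ψ)) : Integrable F (bornLaw s φ) := by
  have := (isOutcomeLaw_bornLaw s φ).1
  have hfin : IsFiniteMeasure ((haarState d).withDensity fun ψ =>
      ENNReal.ofReal (symDim d s * overlap φ ψ ^ s)) := by
    refine ⟨?_⟩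
    have h := measure_lt_top (bornLaw s φ) Set.univ
    rwa [bornLaw, Measure.map_apply measurable_inl MeasurableSet.univ] at h
  rw [bornLaw, measurableEmbedding_inl.integrable_map_iff]
  exact hF.integrable_of_hasCompactSupport (HasCompactSupport.of_compactSpace _)

/-- Normalization of the Born law evaluates the overlap moment as `1/κ_s`, with no need to solve its
recursion. -/
theorem symDim_mul_integral_overlap_pow (s : ℕ) (φ : Ket d) :
    (symDim d s : ℂ) * ∫ ψ, (overlap φ ψ : ℂ) ^ s ∂haarState d = 1 := by
  have := (isOutcomeLaw_bornLaw s φ).1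
  have h := integral_bornLaw s φ fun _ => 1
  simpa using h.symm

end Measurement

/-! ### The mean and the second moment of the outcome -/

section OutcomeMoments

open scoped ComplexConjugate

variable {d : ℕ} [NeZero d]

theorem symDim_mul_overlapMoment (s : ℕ) (φ : Ket d) :
    (symDim d s : ℂ) * overlapMoment φ.1 s = 1 := by
  rw [← symDim_mul_integral_overlap_pow s φ]
  simp only [ofReal_overlap, overlapMoment, haarPairing, mul_pow, map_pow]

omit [NeZero d] in
theorem tensorPow_two_apply (A : Matrix (Fin d) (Fin d) ℂ) (x y : Fin 2 → Fin d) :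
    tensorPow A 2 x y = A (x 0) (y 0) * A (x 1) (y 1) := by
  simp [tensorPow, Fin.prod_univ_two]

omit [NeZero d] in
theorem inner_single_single (a b : Fin d) :
    (inner ℂ (EuclideanSpace.single a (1 : ℂ)) (EuclideanSpace.single b (1 : ℂ)) : ℂ) =
      if a = b then 1 else 0 := by
  simp [EuclideanSpace.inner_single_left]

omit [NeZero d] in
theorem inner_single_ket (a : Fin d) (φ : Ket d) :
    (inner ℂ (EuclideanSpace.single a (1 : ℂ)) φ.1 : ℂ) = φ.1 a := by
  simp [EuclideanSpace.inner_single_left]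

omit [NeZero d] in
theorem inner_ket_single (φ : Ket d) (b : Fin d) :
    (inner ℂ φ.1 (EuclideanSpace.single b (1 : ℂ)) : ℂ) = star (φ.1 b) := by
  simp [EuclideanSpace.inner_single_right]

/-- The projector is `κ_2` times the second Haar moment, and the unweighted case `s = 0` of
`haarPairing_two_two` computes that moment as `(I + SWAP)/(d(d+1))`. The vector `ketZero d` is an
arbitrary choice, since it enters only to the power zero. -/
theorem symProj_two_apply (x y : Fin 2 → Fin d) :
    symProj d 2 x y =
      (1 / 2) * ((if x = y then 1 else 0) + if x = ![y 1, y 0] then 1 else 0) := by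
  have h := haarPairing_two_two (ketZero d) (EuclideanSpace.single (x 0) 1)
    (EuclideanSpace.single (x 1) 1) (EuclideanSpace.single (y 0) 1)
    (EuclideanSpace.single (y 1) 1) 0
  have hM : haarMoment d 2 x y = haarPairing
      (fun z => inner ℂ (EuclideanSpace.single (x 0) (1 : ℂ)) z *
        (inner ℂ (EuclideanSpace.single (x 1) (1 : ℂ)) z * inner ℂ (ketZero d).1 z ^ 0))
      (fun z => inner ℂ (EuclideanSpace.single (y 0) (1 : ℂ)) z *
        (inner ℂ (EuclideanSpace.single (y 1) (1 : ℂ)) z * inner ℂ (ketZero d).1 z ^ 0)) := by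
    refine integral_congr_ae (Filter.Eventually.of_forall fun ψ => ?_)
    simp [tensorPow_ketbra_apply, Fin.prod_univ_two, EuclideanSpace.inner_single_left]
  have hO : overlapMoment (ketZero d).1 0 = 1 := by simp [overlapMoment, haarPairing]
  rw [← hM, hO] at h
  have hS := congrFun (congrFun (symDim_smul_haarMoment (d := d) 2) x) y
  rw [Matrix.smul_apply, smul_eq_mul, symDim_eq] at hS
  have hx : x = y ↔ x 0 = y 0 ∧ x 1 = y 1 := by
    rw [funext_iff, Fin.forall_fin_two]
  have hx' : x = ![y 1, y 0] ↔ x 0 = y 1 ∧ x 1 = y 0 := by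
    rw [funext_iff, Fin.forall_fin_two]
    simp
  simp only [inner_single_single, Nat.cast_zero, zero_mul, add_zero, sub_zero, mul_one] at h
  rw [← hS]
  simp only [hx, hx', ite_and, Nat.ascFactorial_succ, Nat.ascFactorial_zero, Nat.factorial]
  push_cast
  have h2 : (if x 0 = y 0 then if x 1 = y 1 then (1 : ℂ) else 0 else 0) +
      (if x 0 = y 1 then if x 1 = y 0 then 1 else 0 else 0) =
      (d : ℂ) * (d + 1) * haarMoment d 2 x y := by
    rw [h]
    simp only [mul_ite, mul_one, mul_zero]
    split_ifs <;> simp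
  rw [h2]
  ring

theorem mul_symProj_two_apply (B : Op d 2) (x y : Fin 2 → Fin d) :
    (B * symProj d 2) x y = (1 / 2) * (B x y + B x ![y 1, y 0]) := by
  simp only [Matrix.mul_apply, symProj_two_apply]
  have h : ∀ z, B x z * ((1 / 2 : ℂ) * ((if z = y then 1 else 0) +
      if z = ![y 1, y 0] then 1 else 0)) =
      (1 / 2) * ((if z = y then B x z else 0) + if z = ![y 1, y 0] then B x z else 0) := by
    intro z
    split_ifs <;> ring
  simp only [h]
  rw [← Finset.mul_sum, Finset.sum_add_distrib]
  simp

theorem integrable_outcomeState (s : ℕ) (φ : Ket d) (i j : Fin d) :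
    Integrable (fun y => outcomeState y i j) (bornLaw s φ) := by
  refine integrable_bornLaw s φ ?_
  simp only [outcomeState, Sum.elim_inl, ketbra_apply]
  fun_prop

theorem integrable_tensorPow_outcomeState (s : ℕ) (φ : Ket d) (k : ℕ) (x y : Fin k → Fin d) :
    Integrable (fun z => tensorPow (outcomeState z) k x y) (bornLaw s φ) :=
  integrable_bornLaw s φ (continuous_tensorPow_ketbra x y)

/-- The mean outcome state of the symmetric joint measurement. -/
theorem matIntegral_outcomeState (s : ℕ) (φ : Ket d) :
    matIntegral (bornLaw s φ) outcomeState =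
      (1 / ((d : ℂ) + s)) • (1 + (s : ℂ) • ketbra φ) := by
  ext i j
  have hN := symDim_mul_overlapMoment s φ
  have h := haarPairing_one_one φ (EuclideanSpace.single i 1) (EuclideanSpace.single j 1) s
  have hI : ∫ y, outcomeState y i j ∂bornLaw s φ = symDim d s * haarPairing
      (fun x => inner ℂ (EuclideanSpace.single i (1 : ℂ)) x * inner ℂ φ.1 x ^ s)
      (fun x => inner ℂ (EuclideanSpace.single j (1 : ℂ)) x * inner ℂ φ.1 x ^ s) := by
    rw [integral_bornLaw]
    congr 1
    refine integral_congr_ae (Filter.Eventually.of_forall fun ψ => ?_)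
    simp only [outcomeState, Sum.elim_inl, ketbra_apply, ofReal_overlap,
      EuclideanSpace.inner_single_left, map_one, one_mul, map_mul, map_pow, Complex.star_def]
    ring
  have hd := natCast_add_ne_zero (d := d) s
  change ∫ y, outcomeState y i j ∂bornLaw s φ = _
  rw [hI]
  simp only [Matrix.smul_apply, Matrix.add_apply, Matrix.one_apply, smul_eq_mul, ketbra_apply]
  simp only [inner_single_single, inner_single_ket, inner_ket_single] at h
  rw [div_mul_eq_mul_div, eq_div_iff hd]
  linear_combination (symDim d s : ℂ) * h +
    ((if i = j then 1 else 0) + s * (φ.1 i * star (φ.1 j))) * hN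

/-- The second moment of the outcome state of the symmetric joint measurement. -/
theorem matIntegral_tensorPow_outcomeState (s : ℕ) (φ : Ket d) :
    matIntegral (bornLaw s φ) (fun y => tensorPow (outcomeState y) 2) =
      (2 / (((d : ℂ) + s) * ((d : ℂ) + s + 1))) •
        ((tensorPow (1 + (s : ℂ) • ketbra φ) 2
            - ((s : ℂ) * ((s : ℂ) + 1) / 2) • tensorPow (ketbra φ) 2) * symProj d 2) := by
  ext x y
  have hN := symDim_mul_overlapMoment s φ
  have h := haarPairing_two_two φ (EuclideanSpace.single (x 0) 1)
    (EuclideanSpace.single (x 1) 1) (EuclideanSpace.single (y 0) 1)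
    (EuclideanSpace.single (y 1) 1) s
  have hI : ∫ z, tensorPow (outcomeState z) 2 x y ∂bornLaw s φ = symDim d s * haarPairing
      (fun z => inner ℂ (EuclideanSpace.single (x 0) (1 : ℂ)) z *
        (inner ℂ (EuclideanSpace.single (x 1) (1 : ℂ)) z * inner ℂ φ.1 z ^ s))
      (fun z => inner ℂ (EuclideanSpace.single (y 0) (1 : ℂ)) z *
        (inner ℂ (EuclideanSpace.single (y 1) (1 : ℂ)) z * inner ℂ φ.1 z ^ s)) := by
    rw [integral_bornLaw]
    congr 1
    refine integral_congr_ae (Filter.Eventually.of_forall fun ψ => ?_)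
    simp only [outcomeState, Sum.elim_inl, tensorPow_two_apply, ketbra_apply, ofReal_overlap,
      EuclideanSpace.inner_single_left, map_one, one_mul, map_mul, map_pow, Complex.star_def]
    ring
  have hd := natCast_add_ne_zero (d := d) s
  have hd' : (d : ℂ) + s + 1 ≠ 0 := by
    have := natCast_add_ne_zero (d := d) (s + 1)
    push_cast at this
    rwa [← add_assoc] at this
  change ∫ z, tensorPow (outcomeState z) 2 x y ∂bornLaw s φ = _
  -- Right multiplication by the projector averages over swapping the entries of `y`. This yields
  -- the two products of `haarPairing_two_two`, while the `ρ^{⊗2}` term is unchanged by the swap, so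
  -- `s(s + 1)/2` is counted twice.
  rw [hI, Matrix.smul_apply, mul_symProj_two_apply]
  simp only [Matrix.smul_apply, Matrix.sub_apply, Matrix.add_apply, Matrix.one_apply, smul_eq_mul,
    ketbra_apply, tensorPow_two_apply, Matrix.cons_val_zero, Matrix.cons_val_one]
  simp only [inner_single_single, inner_single_ket, inner_ket_single] at h
  rw [div_mul_eq_mul_div, eq_div_iff (mul_ne_zero hd hd')]
  generalize haarPairing (d := d) _ _ = D at h ⊢
  generalize overlapMoment φ.1 s = N at h hN
  generalize (if x 0 = y 0 then (1 : ℂ) else 0) = e1 at *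
  generalize (if x 0 = y 1 then (1 : ℂ) else 0) = e2 at *
  generalize (if x 1 = y 0 then (1 : ℂ) else 0) = e3 at *
  generalize (if x 1 = y 1 then (1 : ℂ) else 0) = e4 at *
  linear_combination (symDim d s : ℂ) * h +
    ((e1 + s * (φ.1 (x 0) * star (φ.1 (y 0)))) * (e4 + s * (φ.1 (x 1) * star (φ.1 (y 1)))) +
      (e2 + s * (φ.1 (x 0) * star (φ.1 (y 1)))) * (e3 + s * (φ.1 (x 1) * star (φ.1 (y 0)))) -
      s * (s + 1) * (φ.1 (x 0) * φ.1 (x 1) * star (φ.1 (y 0)) * star (φ.1 (y 1)))) * hN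

end OutcomeMoments

end QuditShadow

end

theorem mainTheorem6 (d s : ℕ) [NeZero d] (ρ : Matrix (Fin d) (Fin d) ℂ)
    (hρ : QuditShadow.IsPureState ρ) :
    QuditShadow.IsPOVM (QuditShadow.symMeasurement d s) ∧
    (∃ P : Measure (QuditShadow.Outcome d), QuditShadow.IsOutcomeLaw
      (QuditShadow.symMeasurement d s) (QuditShadow.tensorPow ρ s) P) ∧
    ∀ {Ω : Type*} [MeasurableSpace Ω] (P : Measure Ω) [IsProbabilityMeasure P]
      (X : Ω → QuditShadow.Outcome d), Measurable X →
      QuditShadow.IsOutcomeLaw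
        (QuditShadow.symMeasurement d s) (QuditShadow.tensorPow ρ s) (P.map X) →
      (∀ᵐ ω ∂P, X ω ≠ Sum.inr ()) ∧
      (∀ i j, Integrable (fun ω => QuditShadow.outcomeState (X ω) i j) P) ∧
      (∀ x y, Integrable
        (fun ω => QuditShadow.tensorPow (QuditShadow.outcomeState (X ω)) 2 x y) P) ∧
      QuditShadow.matIntegral P (fun ω => QuditShadow.outcomeState (X ω)) =
        (1 / ((d : ℂ) + s)) • (1 + (s : ℂ) • ρ) ∧
      QuditShadow.matIntegral P
          (fun ω => QuditShadow.tensorPow (QuditShadow.outcomeState (X ω)) 2) =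
        (2 / (((d : ℂ) + s) * ((d : ℂ) + s + 1))) •
          ((QuditShadow.tensorPow (1 + (s : ℂ) • ρ) 2
              - ((s : ℂ) * ((s : ℂ) + 1) / 2) • QuditShadow.tensorPow ρ 2)
            * QuditShadow.symProj d 2) := by
  obtain ⟨φ, rfl⟩ := hρ
  refine ⟨QuditShadow.isPOVM_symMeasurement s, ⟨_, QuditShadow.isOutcomeLaw_bornLaw s φ⟩, ?_⟩
  intro Ω _ P _ X hX hlaw
  -- The Born rule fixes the probability of every event, hence the law of `X`, so the moments can be
  -- computed under the explicit density.
  have hmap : P.map X = QuditShadow.bornLaw s φ :=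
    hlaw.unique (QuditShadow.isOutcomeLaw_bornLaw s φ)
  have h1 := QuditShadow.integrable_outcomeState s φ
  have h2 := QuditShadow.integrable_tensorPow_outcomeState s φ 2
  rw [← hmap] at h1 h2
  refine ⟨?_, fun i j => (h1 i j).comp_measurable hX, fun x y => (h2 x y).comp_measurable hX,
    ?_, ?_⟩
  · have h := QuditShadow.bornLaw_inr s φ
    rw [← hmap] at h
    exact ae_of_ae_map hX.aemeasurable (measure_eq_zero_iff_ae_notMem.mp h)
  · rw [← QuditShadow.matIntegral_outcomeState, ← hmap]
    ext i j
    exact (integral_map hX.aemeasurable (h1 i j).1).symm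
  · rw [← QuditShadow.matIntegral_tensorPow_outcomeState, ← hmap]
    ext x y
    exact (integral_map hX.aemeasurable (h2 x y).1).symm
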